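/- \textbf{Theorem (asymptotic equivalence of the constraints).} Let $(X,S)$ be a random pair with values in $\mathcal X\times\mathcal S$, where $\mathcal X\subset\mathbb R^d$ (more generally, any measurable space) and $\mathcal S\subset\mathbb R$ is an interval, and let $\mu_S$ be Lebesgue measure on $\mathcal S$. Let $(X_1,S_1),\dots,(X_n,S_n)$ be i.i.d. copies of $(X,S)$. Assume: (1) $K_\gamma(s,s')=k((s-s')/\gamma)$, where $k:\mathbb R\to[0,\infty)$ is measurable, bounded and symmetric, $\int k(s)\,ds=1$ and $\int s^2k(s)\,ds<\infty$. (2) The law of $S$ has a density $p(s)$ with respect to $\mu_S$, and $L_p<p(s)<U_p$ on $\mathcal S$ for some $0<L_p<U_p<\infty$. (3) There is a $\sigma$-finite measure $\mu_X$ on $\mathcal X$ such that the law of $(X,S)$ has a density $p(x,s)$ with respect to $\mu_X\otimes\mu_S$; for every $x\in\mathcal X$ the function $s\mapsto p(x,s)$ is twice differentiable on $\mathcal S$ with bounded second derivative; and $\sup_{s\in\mathcal S}\int_{\mathcal X}|\partial_s^2p(x,s)|\,d\mu_X(x)<\infty$. (4) The bandwidths $\gamma_n>0$ satisfy $\gamma_n\to0$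 and $n\gamma_n\to\infty$. Let $\mathcal Z$ be a nonempty Borel subset of $\mathbb R^m$ with the distance given by some norm (more generally, a nonempty separable metric space whose Borel $\sigma$-algebra is standard). Let $\mathcal V$ be a set of functions $v:\mathcal Z\to\mathbb R$ with $\|v\|_\infty\le1$ which are all Lipschitz with the same constant $L>0$, and let $\mathcal H$ be a set of measurable encoders $h:\mathcal X\to\mathcal Z$. For a set $\mathcal F$ of functions let $\mathcal N(r,\mathcal F,\|\cdot\|_\infty)$ be the least number of functions (not necessarily in $\mathcal F$) such that every element of $\mathcal F$ is within uniform distance $r$ of one of them; assume that $\mathcal N(r,\mathcal V,\|\cdot\|_\infty)$ and $\mathcal N(r,\mathcal H,\|\cdot\|_\infty)$ are finite for every $r>0$. For finite measures $P^0,P^1$ on $\mathcal Z$ put $\mathrm{IPM}_{\mathcal V}(P^0,P^1)=\sup_{v\in\mathcal V}\left|\int v\,dP^0-\int v\,dP^1\right|$. For $h\in\mathcal H$ let $$\mathrm{EIPM}_{\mathcal V}(h(X);S)=\mathbb E_S\left[\mathrm{IPM}_{\mathcal V}\left(\mathbb P_{h(X)|S},\mathbb P_{h(X)}\right)\right],$$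 $$\widehat{\mathrm{EIPM}}{}^{\gamma}_{\mathcal V}(h(X);S)=\frac1n\sum_{i=1}^n\mathrm{IPM}_{\mathcal V}\left(\sum_{j\ne i}\widehat w_\gamma(j;i)\,\delta_{h(X_j)},\ \frac1{n-1}\sum_{j\neq i}\delta_{h(X_j)}\right),\qquad \widehat w_\gamma(j;i)=\frac{K_\gamma(S_j,S_i)}{\sum_{l\ne i}K_\gamma(S_l,S_i)}$$ (with the convention $0/0=0$). For real $\delta$ let $\mathcal H_{\mathcal V}(\delta)=\{h\in\mathcal H:\mathrm{EIPM}_{\mathcal V}(h(X);S)\le\delta\}$ and $\widehat{\mathcal H}^{\gamma}_{\mathcal V}(\delta)=\{h\in\mathcal H:\widehat{\mathrm{EIPM}}{}^{\gamma}_{\mathcal V}(h(X);S)\le\delta\}$. Let $$\epsilon_n=\gamma_n^2+\frac{\log n}{\sqrt{n\gamma_n}}\left(1+\log\mathcal N\left(\tfrac12\sqrt{\tfrac{\gamma_n}{n}},\mathcal V,\|\cdot\|_\infty\right)+\log\mathcal N\left(\tfrac1{2L}\sqrt{\tfrac{\gamma_n}{n}},\mathcal H,\|\cdot\|_\infty\right)\right)^{1/2}.$$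 Then there is a constant $c>0$, not depending on $n$, on $\delta$, or on $\mathcal Z$ (in particular not on its dimension $m$), $L$, $\mathcal V$, $\mathcal H$, such that for every $\delta>0$ and all sufficiently large $n$, with probability at least $1-\frac4n$, $$\mathcal H_{\mathcal V}(\delta-c\,\epsilon_n)\subseteq\widehat{\mathcal H}^{\gamma_n}_{\mathcal V}(\delta)\subseteq\mathcal H_{\mathcal V}(\delta+c\,\epsilon_n).$$ (If the event is not measurable, this means that the outer probability of its complement is at most $4/n$.) -/

import Mathlib

open MeasureTheory ProbabilityTheory Filter Topology
open scoped NNReal ENNReal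

noncomputable section

namespace FairRep

/-- The integral probability metric
`IPM_V(P⁰, P¹) = sup_{v ∈ V} |∫ v dP⁰ - ∫ v dP¹|`. -/
def IPM {Z : Type*} [MeasurableSpace Z] (V : Set (Z → ℝ)) (P₀ P₁ : Measure Z) : ℝ :=
  ⨆ v : V, |(∫ z, (v : Z → ℝ) z ∂P₀) - ∫ z, (v : Z → ℝ) z ∂P₁|

/-- `EIPM_V(h(X); S) = E_S [IPM_V(P_{h(X) | S}, P_{h(X)})]`, where `P` is the joint law of `(X, S)`
and the conditional law is the regular conditional distribution of `h(X)` given `S`. -/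
def EIPM {X Z : Type*} [MeasurableSpace X] [MeasurableSpace Z] [StandardBorelSpace Z] [Nonempty Z]
    (P : Measure (X × ℝ)) [IsFiniteMeasure P] (V : Set (Z → ℝ)) (h : X → Z) : ℝ :=
  ∫ s, IPM V (condDistrib (fun ω : X × ℝ => h ω.1) (fun ω : X × ℝ => ω.2) P s)
    (P.map fun ω => h ω.1) ∂(P.map fun ω => ω.2)

/-- The kernel with bandwidth `γ` on the sensitive attribute: `K_γ(s, s') = k((s - s') / γ)`. -/
def scaledKernel (k : ℝ → ℝ) (γ s s' : ℝ) : ℝ := k ((s - s') / γ)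

/-- The weight `ŵ_γ(j; i) = K_γ(S_j, S_i) / ∑_{l ≠ i} K_γ(S_l, S_i)`. -/
def weight (k : ℝ → ℝ) (γ : ℝ) {n : ℕ} (S : Fin n → ℝ) (j i : Fin n) : ℝ :=
  scaledKernel k γ (S j) (S i) / ∑ l ∈ Finset.univ.erase i, scaledKernel k γ (S l) (S i)

/-- The leave-one-out kernel-weighted empirical distribution `∑_{j ≠ i} ŵ_γ(j; i) δ(Z_j)`, which
estimates the conditional law given `S = S_i`. -/
def condEmpirical {Z : Type*} [MeasurableSpace Z] (k : ℝ → ℝ) (γ : ℝ) {n : ℕ} (z : Fin n → Z)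
    (S : Fin n → ℝ) (i : Fin n) : Measure Z :=
  ∑ j ∈ Finset.univ.erase i, ENNReal.ofReal (weight k γ S j i) • Measure.dirac (z j)

/-- The leave-one-out empirical distribution `(n - 1)⁻¹ ∑_{j ≠ i} δ(Z_j)`. -/
def margEmpirical {Z : Type*} [MeasurableSpace Z] {n : ℕ} (z : Fin n → Z) (i : Fin n) :
    Measure Z :=
  ∑ j ∈ Finset.univ.erase i, ENNReal.ofReal (1 / ((n : ℝ) - 1)) • Measure.dirac (z j)

/-- The estimated EIPM, computed from the sample `(X_1, S_1), …, (X_n, S_n)`: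
the average over `i` of the IPM between the two leave-one-out empirical distributions. -/
def estEIPM {X Z : Type*} [MeasurableSpace Z] (k : ℝ → ℝ) (γ : ℝ) (V : Set (Z → ℝ)) (h : X → Z)
    {n : ℕ} (ω : Fin n → X × ℝ) : ℝ :=
  (1 / (n : ℝ)) * ∑ i, IPM V
    (condEmpirical k γ (fun j => h (ω j).1) (fun j => (ω j).2) i)
    (margEmpirical (fun j => h (ω j).1) i)

/-- The encoders in `H` whose EIPM is at most `δ`. -/
def fairEncoders {X Z : Type*} [MeasurableSpace X] [MeasurableSpace Z] [StandardBorelSpace Z]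
    [Nonempty Z] (P : Measure (X × ℝ)) [IsFiniteMeasure P] (V : Set (Z → ℝ)) (H : Set (X → Z))
    (δ : ℝ) : Set (X → Z) :=
  {h | h ∈ H ∧ EIPM P V h ≤ δ}

/-- The encoders in `H` whose estimated EIPM is at most `δ`. -/
def estFairEncoders {X Z : Type*} [MeasurableSpace Z] (k : ℝ → ℝ) (γ : ℝ) (V : Set (Z → ℝ))
    (H : Set (X → Z)) {n : ℕ} (ω : Fin n → X × ℝ) (δ : ℝ) : Set (X → Z) :=
  {h | h ∈ H ∧ estEIPM k γ V h ω ≤ δ}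

/-- The covering number `𝒩(r, F, ‖·‖_∞)`: the least number of functions `α → β` such that every
element of `F` is within uniform distance `r` of one of them (these centres need not lie in `F`). -/
def supCoveringNumber {α β : Type*} [PseudoEMetricSpace β] (r : ℝ≥0) (F : Set (α → β)) : ℕ∞ :=
  Metric.externalCoveringNumber r (UniformFun.ofFun '' F)

/-- The rate
`ε_n = γ² + log n / √(n γ) * (1 + log 𝒩(√(γ/n)/2, V) + log 𝒩(√(γ/n)/(2L), H))^{1/2}`. -/
def rate {X Z : Type*} [PseudoEMetricSpace Z] (γ : ℝ) (L : ℝ≥0) (V : Set (Z → ℝ))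
    (H : Set (X → Z)) (n : ℕ) : ℝ :=
  γ ^ 2 + Real.log n / √(n * γ) *
    √(1 + Real.log ((supCoveringNumber (1 / 2 * √(γ / n)).toNNReal V).toNat : ℝ)
        + Real.log ((supCoveringNumber (1 / (2 * L) * √(γ / n)).toNNReal H).toNat : ℝ))

/-- The conditions on the smoothing function `k`: nonnegative, bounded, symmetric, with total
integral one and finite second moment. -/
structure IsSmoothingFunction (k : ℝ → ℝ) : Prop where
  measurable : Measurable k
  nonneg : ∀ s, 0 ≤ k s
  bounded : ∃ M : ℝ, ∀ s, k s ≤ M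
  integral_eq_one : ∫ s, k s = 1
  second_moment : Integrable fun s => s ^ 2 * k s
  symm : ∀ s, k (-s) = k s

/-- The law of `S` has a density with respect to Lebesgue measure on `𝒮` which is bounded away from
zero and infinity on `𝒮`. -/
def HasBoundedDensity {X : Type*} [MeasurableSpace X] (P : Measure (X × ℝ)) (𝒮 : Set ℝ) : Prop :=
  ∃ (p : ℝ → ℝ) (Lp Up : ℝ), Measurable p ∧ 0 < Lp ∧ (∀ s ∈ 𝒮, Lp < p s ∧ p s < Up) ∧
    (P.map fun ω => ω.2) = (volume.restrict 𝒮).withDensity fun s => ENNReal.ofReal (p s)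

/-- The joint law of `(X, S)` has a density `p(x, s)` with respect to `μ_X ⊗ Lebesgue|_𝒮` for some
`σ`-finite `μ_X`; for every `x`, `p(x, ·)` is twice differentiable on `𝒮` with bounded second
derivative, and the `L¹(μ_X)` norm of `∂²p/∂s²(·, s)` is bounded over `s ∈ 𝒮`. -/
def HasSmoothJointDensity {X : Type*} [MeasurableSpace X] (P : Measure (X × ℝ)) (𝒮 : Set ℝ) :
    Prop :=
  ∃ (μX : Measure X) (p : X → ℝ → ℝ), SigmaFinite μX ∧ Measurable (Function.uncurry p) ∧
    (∀ x, ∀ s ∈ 𝒮, 0 ≤ p x s) ∧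
    P = (μX.prod (volume.restrict 𝒮)).withDensity (fun ω => ENNReal.ofReal (p ω.1 ω.2)) ∧
    (∀ x, DifferentiableOn ℝ (p x) 𝒮 ∧ DifferentiableOn ℝ (derivWithin (p x) 𝒮) 𝒮 ∧
      ∃ B : ℝ, ∀ s ∈ 𝒮, |derivWithin (derivWithin (p x) 𝒮) 𝒮 s| ≤ B) ∧
    ∃ B : ℝ, ∀ s ∈ 𝒮,
      ∫⁻ x, ENNReal.ofReal |derivWithin (derivWithin (p x) 𝒮) 𝒮 s| ∂μX ≤ ENNReal.ofReal B

end FairRep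

end

/-!
The two families of encoders are compared through one uniform estimate: with probability at least
`1 - 4 / n`, the estimated EIPM and the EIPM differ by at most a multiple of the rate for all
encoders at once. The inclusions follow immediately.

Write `K(s, s') = k((s - s') / γ)`. The joint density provides a version `κ` of the conditional law
of `X` given `S`, and the EIPM is the mean over `S` of `sup_v |∫ v ∘ h dκ(S) - E v(h(X))|`
(`EIPM_eq_integral_condDiscrepancy`). For a test function `f = v ∘ h` the kernel estimator is a
ratio `N / D` of sums over the sample points other than the `i`-th. Since `|N| ≤ D`, its error is
bounded by the deviations of `N` and of `D` from their conditional means and by the bias of the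
population ratio, with no lower bound needed on the random denominator (`abs_ratio_sub_le`).

* Bias. By the mean value theorem and the bound on `∂²p/∂s²`, the density has a first-order
  expansion in `L¹(μ_X)` with a remainder of second order (`lintegral_taylor_le`). The linear term
  is multiplied by the first moment of the kernel over the interval `𝒮`, which vanishes by symmetry
  except for the part of the kernel sticking out of `𝒮`. Near the boundary this costs a bias of
  order `γ`, but only on a set of measure of order `γ`, so that the bias averaged over the sample is
  of order `γ ^ 2` (`abs_bias_le`, `lintegral_boundaryTail_le`). This is why boundedness of the
  second moment of `k` suffices and no boundary correction is required.
* Variance. Conditionally on the `i`-th point, `N` is a sum of i.i.d. bounded terms with second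
  moment of order `γ`, and Bernstein's inequality gives deviations of order `√(t / (n γ))` after
  normalisation, with probability `1 - 2 exp (-t)` (`pi_abs_sum_erase_sub_gt_le`).
* Uniformity. The sets `V` and `H` are replaced by finite covers at scale `√(γ / n)`. With
  `t = 4 log n + log 𝒩(V) + log 𝒩(H)` a union bound over the covers, the sample points and the
  finitely many other averages costs at most `4 / n` (`measure_not_isGoodSample_le`,
  `failure_probability_le`).

Bernstein's inequality is in its Gaussian regime only if `t` is small compared with `n γ`. Otherwise
the rate is bounded below, and the estimate is trivial because both quantities lie in `[0, 2]`.
-/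

namespace FairRep

/-! ### Exponential concentration for bounded functions of an i.i.d. sample -/

section Concentration

variable {Ω : Type*} [MeasurableSpace Ω] {μ : Measure Ω} [IsProbabilityMeasure μ]

/-- The Bernstein-type bound on the moment generating function, from `exp x ≤ 1 + x + x ^ 2` on
`[-1, 1]`. -/
lemma integral_exp_mul_le {Y : Ω → ℝ} (hY : Measurable Y) {M v l : ℝ} (hM : ∀ ω, |Y ω| ≤ M)
    (hv : ∫ ω, Y ω ^ 2 ∂μ ≤ v) (hl : 0 ≤ l) (hlM : l * M ≤ 1) :
    ∫ ω, Real.exp (l * Y ω) ∂μ ≤ Real.exp (l * ∫ ω, Y ω ∂μ + l ^ 2 * v) := by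
  have hb : ∀ ω, |l * Y ω| ≤ 1 := fun ω => by
    rw [abs_mul, abs_of_nonneg hl]
    exact (mul_le_mul_of_nonneg_left (hM ω) hl).trans hlM
  have hYi : Integrable Y μ :=
    Integrable.of_bound hY.aestronglyMeasurable M (ae_of_all _ fun ω => by simpa using hM ω)
  have hY2 : Integrable (fun ω => Y ω ^ 2) μ :=
    Integrable.of_bound (hY.pow_const 2).aestronglyMeasurable (M ^ 2) (ae_of_all _ fun ω => by
      rw [Real.norm_eq_abs, abs_pow]
      exact pow_le_pow_left₀ (abs_nonneg _) (hM ω) 2)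
  have hexp : Integrable (fun ω => Real.exp (l * Y ω)) μ :=
    Integrable.of_bound (by fun_prop) (Real.exp 1) (ae_of_all _ fun ω => by
      rw [Real.norm_eq_abs, Real.abs_exp]
      exact Real.exp_le_exp.2 ((le_abs_self _).trans (hb ω)))
  calc ∫ ω, Real.exp (l * Y ω) ∂μ ≤ ∫ ω, (1 + (l * Y ω + l ^ 2 * Y ω ^ 2)) ∂μ := by
        refine integral_mono hexp ?_ fun ω => ?_
        · exact (integrable_const _).add ((hYi.const_mul l).add (hY2.const_mul _))
        · have := (abs_le.1 (Real.abs_exp_sub_one_sub_id_le (hb ω))).2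
          dsimp only
          nlinarith
    _ = 1 + (l * ∫ ω, Y ω ∂μ + l ^ 2 * ∫ ω, Y ω ^ 2 ∂μ) := by
        have h1 : Integrable (fun ω => l * Y ω + l ^ 2 * Y ω ^ 2) μ :=
          (hYi.const_mul l).add (hY2.const_mul _)
        rw [integral_add (integrable_const _) h1,
          integral_add (hYi.const_mul l) (hY2.const_mul _), integral_const_mul, integral_const_mul]
        simp
    _ ≤ 1 + (l * ∫ ω, Y ω ∂μ + l ^ 2 * v) := by
        have := mul_le_mul_of_nonneg_left hv (sq_nonneg l)
        linarith
    _ ≤ _ := by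
        rw [add_comm]
        exact Real.add_one_le_exp _

lemma pi_sum_ge_le {Y : Ω → ℝ} (hY : Measurable Y) {M v l : ℝ} (hM : ∀ ω, |Y ω| ≤ M)
    (hv : ∫ ω, Y ω ^ 2 ∂μ ≤ v) (hl : 0 ≤ l) (hlM : l * M ≤ 1) (m : ℕ) (τ : ℝ) :
    (Measure.pi fun _ : Fin m => μ) {ω | m * ∫ x, Y x ∂μ + τ ≤ ∑ j, Y (ω j)}
      ≤ ENNReal.ofReal (Real.exp (-l * τ + l ^ 2 * (m * v))) := by
  have hint : Integrable (fun ω : Fin m → Ω => Real.exp (l * ∑ j, Y (ω j)))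
      (Measure.pi fun _ : Fin m => μ) := by
    have hs : Measurable fun ω : Fin m → Ω => ∑ j, Y (ω j) :=
      Finset.measurable_sum _ fun j _ => hY.comp (measurable_pi_apply j)
    refine Integrable.of_bound (Real.measurable_exp.comp (hs.const_mul l)).aestronglyMeasurable
      (Real.exp (l * (m * M))) (ae_of_all _ fun ω => ?_)
    rw [Real.norm_eq_abs, Real.abs_exp, Real.exp_le_exp]
    refine mul_le_mul_of_nonneg_left ?_ hl
    calc ∑ j, Y (ω j) ≤ ∑ _j : Fin m, M := Finset.sum_le_sum fun j _ => (abs_le.1 (hM _)).2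
      _ = m * M := by simp
  have h1 := measure_ge_le_exp_mul_mgf (μ := Measure.pi fun _ : Fin m => μ)
    (X := fun ω => ∑ j, Y (ω j)) (m * ∫ x, Y x ∂μ + τ) hl hint
  have h2 : mgf (fun ω : Fin m → Ω => ∑ j, Y (ω j)) (Measure.pi fun _ : Fin m => μ) l
      = (∫ ω, Real.exp (l * Y ω) ∂μ) ^ m := by
    simp only [mgf, Finset.mul_sum, Real.exp_sum]
    rw [integral_fintype_prod_eq_pow (fun x => Real.exp (l * Y x)), Fintype.card_fin]
  have h3 : (∫ ω, Real.exp (l * Y ω) ∂μ) ^ m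
      ≤ Real.exp (l * ∫ ω, Y ω ∂μ + l ^ 2 * v) ^ m :=
    pow_le_pow_left₀ (integral_nonneg fun _ => (Real.exp_pos _).le)
      (integral_exp_mul_le hY hM hv hl hlM) m
  rw [h2] at h1
  refine ENNReal.le_ofReal_iff_toReal_le (measure_ne_top _ _) (Real.exp_pos _).le |>.2 ?_
  refine h1.trans ((mul_le_mul_of_nonneg_left h3 (Real.exp_pos _).le).trans (le_of_eq ?_))
  rw [← Real.exp_nat_mul, ← Real.exp_add]
  congr 1
  ring

/-- Two-sided deviation bound with variance proxy `v`, in the regime `M ^ 2 * t ≤ m * v` where the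
Gaussian part of Bernstein's inequality dominates. -/
lemma pi_abs_sum_sub_gt_le {Y : Ω → ℝ} (hY : Measurable Y) {M v t : ℝ} (hM : ∀ ω, |Y ω| ≤ M)
    (hv : ∫ ω, Y ω ^ 2 ∂μ ≤ v) (hv0 : 0 < v) (ht : 0 ≤ t) {m : ℕ} (hm : 0 < m)
    (htm : M ^ 2 * t ≤ m * v) :
    (Measure.pi fun _ : Fin m => μ)
        {ω | 2 * √(t * (m * v)) < |∑ j, Y (ω j) - m * ∫ x, Y x ∂μ|}
      ≤ ENNReal.ofReal (2 * Real.exp (-t)) := by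
  have hmv : 0 < (m : ℝ) * v := by positivity
  -- the minimiser of the exponent `-l τ + l ^ 2 m v` at `τ = 2 √(t m v)`
  set l : ℝ := √(t / (m * v)) with hl
  have hl0 : 0 ≤ l := Real.sqrt_nonneg _
  have hl2 : l ^ 2 = t / (m * v) := Real.sq_sqrt (by positivity)
  have hlM : l * M ≤ 1 := by
    refine abs_le_of_sq_le_sq' ?_ zero_le_one |>.2
    rw [mul_pow, hl2, one_pow, div_mul_eq_mul_div, div_le_one hmv]
    linarith
  have hτ : -l * (2 * √(t * (m * v))) + l ^ 2 * (m * v) = -t := by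
    have : l * √(t * (m * v)) = t := by
      rw [hl, ← Real.sqrt_mul (by positivity)]
      rw [show t / (m * v) * (t * (m * v)) = t ^ 2 by field_simp]
      exact Real.sqrt_sq ht
    have h2 : l ^ 2 * (m * v) = t := by rw [hl2]; field_simp
    rw [h2]
    linarith
  have h1 := pi_sum_ge_le (μ := μ) hY hM hv hl0 hlM m (2 * √(t * (m * v)))
  have h2 := pi_sum_ge_le (μ := μ) (Y := fun ω => -Y ω) hY.neg (by simpa using hM)
    (by simpa using hv) hl0 hlM m (2 * √(t * (m * v)))
  rw [hτ] at h1 h2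
  calc _ ≤ (Measure.pi fun _ : Fin m => μ)
        ({ω | m * ∫ x, Y x ∂μ + 2 * √(t * (m * v)) ≤ ∑ j, Y (ω j)} ∪
          {ω | m * ∫ x, -Y x ∂μ + 2 * √(t * (m * v)) ≤ ∑ j, -Y (ω j)}) := by
        refine measure_mono fun ω hω => ?_
        simp only [Set.mem_ofPred_eq, Set.mem_union, integral_neg, Finset.sum_neg_distrib] at hω ⊢
        rcases lt_abs.1 hω with h | h
        · left; linarith
        · right; linarith
    _ ≤ _ := (measure_union_le _ _).trans (add_le_add h1 h2)
    _ = _ := by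
        rw [← ENNReal.ofReal_add (Real.exp_pos _).le (Real.exp_pos _).le, two_mul]

/-- Leave-one-out version: conditionally on the `i`-th sample point, the remaining ones are
i.i.d. -/
lemma pi_abs_sum_erase_sub_gt_le {Y : Ω → Ω → ℝ} (hY : Measurable (Function.uncurry Y))
    {M v t : ℝ} (hM : ∀ y ω, |Y y ω| ≤ M) (hv : ∀ y, ∫ ω, Y y ω ^ 2 ∂μ ≤ v)
    (hv0 : 0 < v) (ht : 0 ≤ t) {m : ℕ} (hm : 0 < m) (htm : M ^ 2 * t ≤ m * v) (i : Fin (m + 1)) :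
    (Measure.pi fun _ : Fin (m + 1) => μ)
        {ω | 2 * √(t * (m * v)) <
          |∑ j ∈ Finset.univ.erase i, Y (ω i) (ω j) - m * ∫ x, Y (ω i) x ∂μ|}
      ≤ ENNReal.ofReal (2 * Real.exp (-t)) := by
  have hYm : ∀ y, Measurable (Y y) := fun y => hY.comp measurable_prodMk_left
  have hI : Measurable fun y => ∫ x, Y y x ∂μ :=
    (hY.stronglyMeasurable.integral_prod_right).measurable
  set A : Set (Ω × (Fin m → Ω)) :=
    {q | 2 * √(t * (m * v)) < |∑ j, Y q.1 (q.2 j) - m * ∫ x, Y q.1 x ∂μ|} with hA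
  have hAm : MeasurableSet A := by
    refine measurableSet_lt measurable_const ?_
    have : ∀ j : Fin m, Measurable fun q : Ω × (Fin m → Ω) => Y q.1 (q.2 j) := fun j =>
      hY.comp (measurable_fst.prodMk ((measurable_pi_apply j).comp measurable_snd))
    have h1 : Measurable fun q : Ω × (Fin m → Ω) => ∑ j, Y q.1 (q.2 j) :=
      Finset.measurable_sum _ fun j _ => this j
    have h2 : Measurable fun q : Ω × (Fin m → Ω) => (m : ℝ) * ∫ x, Y q.1 x ∂μ :=
      (hI.comp measurable_fst).const_mul _
    exact (continuous_abs.measurable).comp (h1.sub h2)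
  have hmp := measurePreserving_piFinSuccAbove (fun _ : Fin (m + 1) => μ) i
  have hpre : {ω : Fin (m + 1) → Ω | 2 * √(t * (m * v)) <
      |∑ j ∈ Finset.univ.erase i, Y (ω i) (ω j) - m * ∫ x, Y (ω i) x ∂μ|}
      = MeasurableEquiv.piFinSuccAbove (fun _ => Ω) i ⁻¹' A := by
    ext ω
    have : ∑ j ∈ Finset.univ.erase i, Y (ω i) (ω j) = ∑ j, Y (ω i) (ω (i.succAbove j)) := by
      have h := Finset.sum_erase_eq_sub (f := fun j => Y (ω i) (ω j)) (Finset.mem_univ i)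
      rw [h, Fin.sum_univ_succAbove _ i]
      ring
    simp only [Set.mem_ofPred_eq, this, hA, Set.mem_preimage]
    rfl
  rw [hpre, hmp.measure_preimage hAm.nullMeasurableSet, Measure.prod_apply hAm]
  calc _ ≤ ∫⁻ _y, ENNReal.ofReal (2 * Real.exp (-t)) ∂μ :=
        lintegral_mono fun y =>
          pi_abs_sum_sub_gt_le (hYm y) (hM y) (hv y) hv0 ht hm htm
    _ = _ := by simp

end Concentration

/-! ### Uniform covers -/

section Covers

/-- A finite cover by elements of the set itself; passing from external to internal centres doubles
the radius. -/
lemma exists_finset_cover {α β : Type*} [PseudoMetricSpace β] {r : ℝ≥0} {F : Set (α → β)}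
    (hF : supCoveringNumber r F ≠ ⊤) :
    ∃ C : Finset (α → β), (∀ c ∈ C, c ∈ F) ∧ C.card ≤ (supCoveringNumber r F).toNat ∧
      ∀ f ∈ F, ∃ c ∈ C, ∀ x, dist (f x) (c x) ≤ 2 * r := by
  have hle := Metric.coveringNumber_two_mul_le_externalCoveringNumber r (UniformFun.ofFun '' F)
  obtain ⟨C, hCF, hCfin, hCc, hcard⟩ := Metric.exists_set_encard_eq_coveringNumber
    (ne_top_of_le_ne_top hF hle)
  classical
  refine ⟨hCfin.toFinset.image UniformFun.toFun, ?_, ?_, ?_⟩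
  · intro c hc
    obtain ⟨d, hd, rfl⟩ := Finset.mem_image.1 hc
    obtain ⟨f, hf, rfl⟩ := hCF (hCfin.mem_toFinset.1 hd)
    exact hf
  · refine Finset.card_image_le.trans ?_
    have h1 : ((hCfin.toFinset.card : ℕ) : ℕ∞) ≤ supCoveringNumber r F := by
      rw [← hCfin.encard_eq_coe_toFinset_card, hcard]
      exact hle
    have := ENat.toNat_le_toNat h1 hF
    simpa using this
  · intro f hf
    obtain ⟨c, hc, hfc⟩ := hCc (Set.mem_image_of_mem UniformFun.ofFun hf)
    refine ⟨UniformFun.toFun c, Finset.mem_image.2 ⟨c, hCfin.mem_toFinset.2 hc, rfl⟩, fun x => ?_⟩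
    have h := UniformFun.edist_le.1 hfc x
    rw [edist_dist, ENNReal.ofReal_le_iff_le_toReal ENNReal.coe_ne_top] at h
    simpa using h

lemma exists_countable_dense {α β : Type*} [PseudoMetricSpace β] {F : Set (α → β)}
    (hF : ∀ r : ℝ≥0, 0 < r → supCoveringNumber r F ≠ ⊤) :
    ∃ D : Set (α → β), D.Countable ∧ D ⊆ F ∧
      ∀ f ∈ F, ∀ ε : ℝ, 0 < ε → ∃ d ∈ D, ∀ x, dist (f x) (d x) ≤ ε := by
  have hpos : ∀ n : ℕ, (0 : ℝ≥0) < 1 / (n + 1) := fun n => by positivity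
  choose C hCF _ hC using fun n : ℕ => exists_finset_cover (hF _ (hpos n))
  refine ⟨⋃ n, (C n : Set (α → β)), Set.countable_iUnion fun n => (C n).countable_toSet,
    Set.iUnion_subset fun n c hc => hCF n c hc, fun f hf ε hε => ?_⟩
  obtain ⟨n, hn⟩ := exists_nat_one_div_lt (half_pos hε)
  obtain ⟨c, hc, hfc⟩ := hC n f hf
  refine ⟨c, Set.mem_iUnion.2 ⟨n, hc⟩, fun x => (hfc x).trans ?_⟩
  push_cast
  linarith

lemma abs_iSup_sub_iSup_le {ι : Type*} {a b : ι → ℝ} {c : ℝ} (hc : 0 ≤ c)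
    (ha : BddAbove (Set.range a)) (hb : BddAbove (Set.range b)) (h : ∀ i, |a i - b i| ≤ c) :
    |(⨆ i, a i) - ⨆ i, b i| ≤ c := by
  rcases isEmpty_or_nonempty ι with hι | hι
  · simpa using hc
  rw [abs_le]
  constructor
  · have : ⨆ i, b i ≤ (⨆ i, a i) + c := ciSup_le fun i => by
      have := (abs_le.1 (h i)).1
      have := le_ciSup ha i
      linarith
    linarith
  · have : ⨆ i, a i ≤ (⨆ i, b i) + c := ciSup_le fun i => by
      have := (abs_le.1 (h i)).2
      have := le_ciSup hb i
      linarith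
    linarith

end Covers

/-! ### The conditional discrepancy -/

section Discrepancy

variable {X Z : Type*} [MeasurableSpace X]

lemma abs_integral_le_of_abs_le {α : Type*} [MeasurableSpace α] {μ : Measure α}
    [IsProbabilityMeasure μ] {f : α → ℝ} {c : ℝ} (hf : ∀ x, |f x| ≤ c) : |∫ x, f x ∂μ| ≤ c := by
  simpa using norm_integral_le_of_norm_le_const (μ := μ) (f := f) (C := c) (ae_of_all _ hf)

lemma integrable_of_abs_le {α : Type*} [MeasurableSpace α] {μ : Measure α}
    [IsFiniteMeasure μ] {f : α → ℝ} {c : ℝ} (hfm : Measurable f) (hf : ∀ x, |f x| ≤ c) :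
    Integrable f μ :=
  Integrable.of_bound hfm.aestronglyMeasurable c (ae_of_all _ fun x => hf x)

lemma abs_integral_sub_integral_le {α : Type*} [MeasurableSpace α] {μ : Measure α}
    [IsProbabilityMeasure μ] {f g : α → ℝ} {c r : ℝ} (hfm : Measurable f) (hgm : Measurable g)
    (hf : ∀ x, |f x| ≤ c) (hg : ∀ x, |g x| ≤ c) (hfg : ∀ x, |f x - g x| ≤ r) :
    |(∫ x, f x ∂μ) - ∫ x, g x ∂μ| ≤ r := by
  rw [← integral_sub (integrable_of_abs_le hfm hf) (integrable_of_abs_le hgm hg)]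
  exact abs_integral_le_of_abs_le hfg

/-- `sup_{v ∈ V} |∫ v ∘ h dκ(s) - ∫ v ∘ h dQ|`: the IPM between the conditional law of `h(X)` given
`S = s` and its marginal law, written on the level of `X`. -/
noncomputable def condDiscrepancy (κ : Kernel ℝ X) (Q : Measure X) (V : Set (Z → ℝ)) (h : X → Z)
    (s : ℝ) : ℝ :=
  ⨆ v : V, |(∫ x, (v : Z → ℝ) (h x) ∂κ s) - ∫ x, (v : Z → ℝ) (h x) ∂Q|

variable {κ : Kernel ℝ X} {Q : Measure X} {V : Set (Z → ℝ)} {h : X → Z}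

lemma condDiscrepancy_nonneg (s : ℝ) : 0 ≤ condDiscrepancy κ Q V h s :=
  Real.iSup_nonneg fun _ => abs_nonneg _

variable [IsMarkovKernel κ] [IsProbabilityMeasure Q]

lemma abs_integral_sub_integral_le_two {α : Type*} [MeasurableSpace α] {μ ν : Measure α}
    [IsProbabilityMeasure μ] [IsProbabilityMeasure ν] {f : α → ℝ} (hf : ∀ x, |f x| ≤ 1) :
    |(∫ x, f x ∂μ) - ∫ x, f x ∂ν| ≤ 2 := by
  have h1 := abs_integral_le_of_abs_le (μ := μ) hf
  have h2 := abs_integral_le_of_abs_le (μ := ν) hf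
  rw [abs_le] at *
  constructor <;> linarith

lemma bddAbove_condDiscrepancy (hV : ∀ v ∈ V, ∀ z, |v z| ≤ 1) (s : ℝ) :
    BddAbove (Set.range fun v : V =>
      |(∫ x, (v : Z → ℝ) (h x) ∂κ s) - ∫ x, (v : Z → ℝ) (h x) ∂Q|) :=
  ⟨2, by rintro _ ⟨v, rfl⟩; exact abs_integral_sub_integral_le_two fun x => hV v v.2 _⟩

lemma condDiscrepancy_le_two (hV : ∀ v ∈ V, ∀ z, |v z| ≤ 1) (s : ℝ) :
    condDiscrepancy κ Q V h s ≤ 2 :=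
  Real.iSup_le (fun v => abs_integral_sub_integral_le_two fun _ => hV v v.2 _) zero_le_two

lemma abs_condDiscrepancy_le_two (hV : ∀ v ∈ V, ∀ z, |v z| ≤ 1) (s : ℝ) :
    |condDiscrepancy κ Q V h s| ≤ 2 := by
  rw [abs_of_nonneg (condDiscrepancy_nonneg s)]
  exact condDiscrepancy_le_two hV s

/-- Replacing the encoder by one that is uniformly close changes the discrepancy by little, since
the test functions are equi-Lipschitz. -/
lemma abs_condDiscrepancy_sub_le {h' : X → Z} {r : ℝ} (hr : 0 ≤ r)
    (hV : ∀ v ∈ V, ∀ z, |v z| ≤ 1) (hm : ∀ v ∈ V, Measurable fun x => v (h x))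
    (hm' : ∀ v ∈ V, Measurable fun x => v (h' x))
    (hr' : ∀ v ∈ V, ∀ x, |v (h x) - v (h' x)| ≤ r) (s : ℝ) :
    |condDiscrepancy κ Q V h s - condDiscrepancy κ Q V h' s| ≤ 2 * r := by
  refine abs_iSup_sub_iSup_le (by positivity) (bddAbove_condDiscrepancy hV s)
    (bddAbove_condDiscrepancy hV s) fun v => (abs_abs_sub_abs_le_abs_sub _ _).trans ?_
  have h1 := abs_integral_sub_integral_le (μ := κ s) (hm v v.2) (hm' v v.2)
    (fun x => hV v v.2 _) (fun x => hV v v.2 _) (hr' v v.2)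
  have h2 := abs_integral_sub_integral_le (μ := Q) (hm v v.2) (hm' v v.2)
    (fun x => hV v v.2 _) (fun x => hV v v.2 _) (hr' v v.2)
  rw [abs_le] at *
  constructor <;> linarith

/-- The supremum over `V` may be taken over a countable uniformly dense subset, so the discrepancy
is measurable in the conditioning value. -/
lemma measurable_condDiscrepancy (hV : ∀ v ∈ V, ∀ z, |v z| ≤ 1)
    (hm : ∀ v ∈ V, Measurable fun x => v (h x))
    (hcov : ∀ r : ℝ≥0, 0 < r → supCoveringNumber r V ≠ ⊤) :
    Measurable (condDiscrepancy κ Q V h) := by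
  obtain ⟨D, hDc, hDV, hD⟩ := exists_countable_dense hcov
  have hm1 : ∀ v ∈ V, Measurable fun s => ∫ x, v (h x) ∂κ s := fun v hv =>
    (StronglyMeasurable.integral_kernel_prod_right' (κ := κ)
      (f := fun q : ℝ × X => v (h q.2))
      ((hm v hv).comp measurable_snd).stronglyMeasurable).measurable
  have heq : condDiscrepancy κ Q V h = condDiscrepancy κ Q D h := by
    funext s
    have hbD : ∀ v ∈ D, ∀ z, |v z| ≤ 1 := fun v hv => hV v (hDV hv)
    apply le_antisymm
    · refine Real.iSup_le (fun v => ?_) (condDiscrepancy_nonneg s)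
      refine le_of_forall_pos_le_add fun ε hε => ?_
      obtain ⟨d, hd, hvd⟩ := hD v v.2 (ε / 2) (half_pos hε)
      have hc : ∀ x, |(v : Z → ℝ) (h x) - d (h x)| ≤ ε / 2 := fun x => hvd (h x)
      have h1 := abs_integral_sub_integral_le (μ := κ s) (hm v v.2) (hm d (hDV hd))
        (fun x => hV v v.2 _) (fun x => hbD d hd _) hc
      have h2 := abs_integral_sub_integral_le (μ := Q) (hm v v.2) (hm d (hDV hd))
        (fun x => hV v v.2 _) (fun x => hbD d hd _) hc
      have h3 : |(∫ x, d (h x) ∂κ s) - ∫ x, d (h x) ∂Q| ≤ condDiscrepancy κ Q D h s :=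
        le_ciSup (bddAbove_condDiscrepancy hbD s) (⟨d, hd⟩ : D)
      rw [abs_le] at *
      constructor <;> linarith
    · exact Real.iSup_le (fun v => le_ciSup (bddAbove_condDiscrepancy hV s)
        (⟨v, hDV v.2⟩ : V)) (condDiscrepancy_nonneg s)
  rw [heq]
  have := hDc.to_subtype
  exact Measurable.iSup fun v =>
    continuous_abs.measurable.comp ((hm1 v (hDV v.2)).sub_const _)

/-- The EIPM is the mean conditional discrepancy, for any version `κ` of the conditional law of `X`
given `S`. -/
lemma EIPM_eq_integral_condDiscrepancy [MeasurableSpace Z] [StandardBorelSpace Z] [Nonempty Z]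
    {P : Measure (X × ℝ)} [IsProbabilityMeasure P]
    (hκ : P.map Prod.swap = (P.map Prod.snd) ⊗ₘ κ) (hh : Measurable h)
    (hVm : ∀ v ∈ V, Measurable v) :
    EIPM P V h = ∫ s, condDiscrepancy κ (P.map Prod.fst) V h s ∂(P.map Prod.snd) := by
  have hc : condDistrib (fun ω : X × ℝ => h ω.1) (fun ω : X × ℝ => ω.2) P
      =ᵐ[P.map fun ω => ω.2] κ.map h := by
    have : IsMarkovKernel (κ.map h) := Kernel.IsMarkovKernel.map κ hh
    refine condDistrib_ae_eq_of_measure_eq_compProd _ (by fun_prop) ?_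
    have h1 : (P.map fun ω : X × ℝ => (ω.2, h ω.1))
        = (P.map Prod.swap).map (Prod.map id h) := by
      rw [Measure.map_map (by fun_prop) measurable_swap]
      rfl
    rw [h1, hκ, Measure.compProd_map hh]
  unfold EIPM
  refine integral_congr_ae (hc.mono fun s hs => ?_)
  simp only [IPM, condDiscrepancy]
  congr 1
  funext v
  rw [hs, Kernel.map_apply _ hh, integral_map hh.aemeasurable
    (hVm v v.2).aestronglyMeasurable, integral_map (by fun_prop) (hVm v v.2).aestronglyMeasurable,
    integral_map (f := fun x => (v : Z → ℝ) (h x)) measurable_fst.aemeasurable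
      ((hVm v v.2).comp hh).aestronglyMeasurable]

end Discrepancy

/-! ### Moments of the rescaled smoothing function -/

section Smoothing

variable {k : ℝ → ℝ}

namespace IsSmoothingFunction

lemma integrable (hk : IsSmoothingFunction k) : Integrable k := by
  by_contra h
  have := hk.integral_eq_one
  rw [integral_undef h] at this
  exact zero_ne_one this

/-- The variance of the smoothing function. -/
noncomputable def var (_ : IsSmoothingFunction k) : ℝ := ∫ s, s ^ 2 * k s

/-- The first absolute moment of the smoothing function. -/
noncomputable def absMoment (_ : IsSmoothingFunction k) : ℝ := ∫ s, |s| * k s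

lemma var_nonneg (hk : IsSmoothingFunction k) : 0 ≤ hk.var :=
  integral_nonneg fun s => mul_nonneg (sq_nonneg _) (hk.nonneg s)

lemma absMoment_nonneg (hk : IsSmoothingFunction k) : 0 ≤ hk.absMoment :=
  integral_nonneg fun s => mul_nonneg (abs_nonneg _) (hk.nonneg s)

lemma integrable_abs_mul (hk : IsSmoothingFunction k) : Integrable fun s => |s| * k s := by
  refine (hk.integrable.add hk.second_moment).mono'
    (continuous_abs.measurable.mul hk.measurable).aestronglyMeasurable (ae_of_all _ fun s => ?_)
  rw [Real.norm_eq_abs, abs_mul, abs_abs, abs_of_nonneg (hk.nonneg s)]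
  have : |s| ≤ 1 + s ^ 2 := by nlinarith [sq_abs s, sq_nonneg (|s| - 1)]
  calc |s| * k s ≤ (1 + s ^ 2) * k s := mul_le_mul_of_nonneg_right this (hk.nonneg s)
    _ = _ := by simp [add_mul]

variable {γ : ℝ}

lemma integrable_scaled (hk : IsSmoothingFunction k) (hγ : 0 < γ) :
    Integrable fun t => k (t / γ) := hk.integrable.comp_div hγ.ne'

lemma integral_scaled (hk : IsSmoothingFunction k) (hγ : 0 < γ) : ∫ t, k (t / γ) = γ := by
  rw [Measure.integral_comp_div, hk.integral_eq_one, abs_of_pos hγ]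
  simp

lemma integrable_sq_scaled (hk : IsSmoothingFunction k) (hγ : 0 < γ) :
    Integrable fun t => t ^ 2 * k (t / γ) := by
  have := (hk.second_moment.comp_div hγ.ne').const_mul (γ ^ 2)
  refine this.congr (ae_of_all _ fun t => ?_)
  field_simp

lemma integral_sq_scaled (hk : IsSmoothingFunction k) (hγ : 0 < γ) :
    ∫ t, t ^ 2 * k (t / γ) = γ ^ 3 * hk.var := by
  have : ∀ t, t ^ 2 * k (t / γ) = γ ^ 2 * ((t / γ) ^ 2 * k (t / γ)) := fun t => by field_simp
  simp_rw [this]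
  rw [integral_const_mul, Measure.integral_comp_div (fun t => t ^ 2 * k t), abs_of_pos hγ, var,
    smul_eq_mul]
  ring

lemma integrable_abs_scaled (hk : IsSmoothingFunction k) (hγ : 0 < γ) :
    Integrable fun t => |t| * k (t / γ) := by
  have := (hk.integrable_abs_mul.comp_div hγ.ne').const_mul γ
  refine this.congr (ae_of_all _ fun t => ?_)
  simp only [abs_div, abs_of_pos hγ]
  field_simp

lemma integral_abs_scaled (hk : IsSmoothingFunction k) (hγ : 0 < γ) :
    ∫ t, |t| * k (t / γ) = γ ^ 2 * hk.absMoment := by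
  have : ∀ t, |t| * k (t / γ) = γ * (|t / γ| * k (t / γ)) := fun t => by
    rw [abs_div, abs_of_pos hγ]; field_simp
  simp_rw [this]
  rw [integral_const_mul, Measure.integral_comp_div (fun t => |t| * k t), abs_of_pos hγ, absMoment,
    smul_eq_mul]
  ring

lemma scaled_neg (hk : IsSmoothingFunction k) (t : ℝ) : k (-t / γ) = k (t / γ) := by
  rw [neg_div, hk.symm]

lemma integrable_mul_scaled (hk : IsSmoothingFunction k) (hγ : 0 < γ) :
    Integrable fun t => t * k (t / γ) := by
  refine (hk.integrable_abs_scaled hγ).mono'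
    (measurable_id.mul (hk.measurable.comp (measurable_id.div_const γ))).aestronglyMeasurable
    (ae_of_all _ fun t => ?_)
  simp [abs_of_nonneg (hk.nonneg _)]

lemma integral_mul_scaled (hk : IsSmoothingFunction k) : ∫ t, t * k (t / γ) = 0 := by
  have h := integral_neg_eq_self (fun t => t * k (t / γ)) volume
  simp only [hk.scaled_neg, neg_mul, integral_neg] at h
  linarith

end IsSmoothingFunction

/-- For an interval `𝒮` the points of `𝒮` that a shift by `t` pushes out of `𝒮` have measure at
most `|t|`. -/
lemma volume_inter_shift_le {𝒮 : Set ℝ} (h𝒮 : 𝒮.OrdConnected) (t : ℝ) :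
    volume {s | s ∈ 𝒮 ∧ s + t ∉ 𝒮} ≤ ENNReal.ofReal |t| := by
  refine (Real.volume_le_diam _).trans (Metric.ediam_le fun a ha b hb => ?_)
  rw [edist_dist, Real.dist_eq]
  refine ENNReal.ofReal_le_ofReal ?_
  by_contra! hlt
  rcases le_total 0 t with ht | ht
  · rw [abs_of_nonneg ht] at hlt
    rcases lt_abs.1 hlt with h | h
    · exact hb.2 (h𝒮.out hb.1 ha.1 ⟨by linarith, by linarith⟩)
    · exact ha.2 (h𝒮.out ha.1 hb.1 ⟨by linarith, by linarith⟩)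
  · rw [abs_of_nonpos ht] at hlt
    rcases lt_abs.1 hlt with h | h
    · exact ha.2 (h𝒮.out hb.1 ha.1 ⟨by linarith, by linarith⟩)
    · exact hb.2 (h𝒮.out ha.1 hb.1 ⟨by linarith, by linarith⟩)

/-- The first absolute moment of the part of the kernel centred at `s` that sticks out of `𝒮`. It
controls the boundary bias of the kernel estimator. -/
noncomputable def boundaryTail (k : ℝ → ℝ) (𝒮 : Set ℝ) (γ s : ℝ) : ℝ :=
  ∫ t, (𝒮ᶜ).indicator (fun _ => |t| * k (t / γ)) (s + t)

variable {𝒮 : Set ℝ} {γ : ℝ}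

lemma measurable_uncurry_tail (hk : IsSmoothingFunction k) (hm : MeasurableSet 𝒮) :
    Measurable fun q : ℝ × ℝ => (𝒮ᶜ).indicator (fun _ => |q.2| * k (q.2 / γ)) (q.1 + q.2) := by
  have h1 : Measurable fun q : ℝ × ℝ => |q.2| * k (q.2 / γ) :=
    (continuous_abs.measurable.comp measurable_snd).mul
      (hk.measurable.comp (measurable_snd.div_const γ))
  have h2 : MeasurableSet {q : ℝ × ℝ | q.1 + q.2 ∈ 𝒮ᶜ} :=
    (measurable_fst.add measurable_snd) hm.compl
  exact h1.indicator h2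

lemma tail_nonneg (hk : IsSmoothingFunction k) (s t : ℝ) :
    0 ≤ (𝒮ᶜ).indicator (fun _ => |t| * k (t / γ)) (s + t) :=
  Set.indicator_nonneg (fun _ _ => mul_nonneg (abs_nonneg _) (hk.nonneg _)) _

lemma tail_le (hk : IsSmoothingFunction k) (s t : ℝ) :
    (𝒮ᶜ).indicator (fun _ => |t| * k (t / γ)) (s + t) ≤ |t| * k (t / γ) :=
  Set.indicator_le_self' (fun _ _ => mul_nonneg (abs_nonneg _) (hk.nonneg _)) _

lemma integrable_tail (hk : IsSmoothingFunction k) (hm : MeasurableSet 𝒮) (hγ : 0 < γ) (s : ℝ) :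
    Integrable fun t => (𝒮ᶜ).indicator (fun _ => |t| * k (t / γ)) (s + t) :=
  (hk.integrable_abs_scaled hγ).mono'
    ((measurable_uncurry_tail hk hm).comp measurable_prodMk_left).aestronglyMeasurable
    (ae_of_all _ fun t => by
      rw [Real.norm_of_nonneg (tail_nonneg hk s t)]
      exact tail_le hk s t)

lemma boundaryTail_nonneg (hk : IsSmoothingFunction k) (s : ℝ) : 0 ≤ boundaryTail k 𝒮 γ s :=
  integral_nonneg fun t => tail_nonneg hk s t

lemma boundaryTail_le (hk : IsSmoothingFunction k) (hm : MeasurableSet 𝒮) (hγ : 0 < γ) (s : ℝ) :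
    boundaryTail k 𝒮 γ s ≤ γ ^ 2 * hk.absMoment := by
  rw [← hk.integral_abs_scaled hγ]
  exact integral_mono (integrable_tail hk hm hγ s) (hk.integrable_abs_scaled hγ)
    fun t => tail_le hk s t

lemma measurable_boundaryTail (hk : IsSmoothingFunction k) (hm : MeasurableSet 𝒮) :
    Measurable (boundaryTail k 𝒮 γ) :=
  ((measurable_uncurry_tail hk hm).stronglyMeasurable.integral_prod_right).measurable

/-- The boundary effect has size `γ ^ 2` at distance at most of order `γ` from the boundary, hence
is of size `γ ^ 3` after integration over `𝒮`. -/
lemma lintegral_boundaryTail_le (hk : IsSmoothingFunction k) (h𝒮 : 𝒮.OrdConnected)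
    (hγ : 0 < γ) :
    ∫⁻ s in 𝒮, ENNReal.ofReal (boundaryTail k 𝒮 γ s) ≤ ENNReal.ofReal (γ ^ 3 * hk.var) := by
  have hm := h𝒮.measurableSet
  have hF := measurable_uncurry_tail (γ := γ) hk hm
  have h1 : ∀ s, ENNReal.ofReal (boundaryTail k 𝒮 γ s)
      = ∫⁻ t, ENNReal.ofReal ((𝒮ᶜ).indicator (fun _ => |t| * k (t / γ)) (s + t)) := fun s =>
    ofReal_integral_eq_lintegral_ofReal (integrable_tail hk hm hγ s)
      (ae_of_all _ fun t => tail_nonneg hk s t)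
  simp_rw [h1]
  rw [lintegral_lintegral_swap hF.ennreal_ofReal.aemeasurable, ← hk.integral_sq_scaled hγ,
    ofReal_integral_eq_lintegral_ofReal (hk.integrable_sq_scaled hγ)
      (ae_of_all _ fun t => mul_nonneg (sq_nonneg _) (hk.nonneg _))]
  refine lintegral_mono fun t => ?_
  have h2 : ∀ s, ENNReal.ofReal ((𝒮ᶜ).indicator (fun _ => |t| * k (t / γ)) (s + t))
      = {s | s + t ∉ 𝒮}.indicator (fun _ => ENNReal.ofReal (|t| * k (t / γ))) s := fun s => by
    by_cases h : s + t ∈ 𝒮 <;> simp [h]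
  have hms : MeasurableSet {s | s + t ∉ 𝒮} := (measurable_id.add_const t) hm.compl
  simp_rw [h2]
  rw [lintegral_indicator_const hms, Measure.restrict_apply hms, Set.inter_comm]
  refine (mul_le_mul_right (volume_inter_shift_le h𝒮 t) _).trans ?_
  rw [← ENNReal.ofReal_mul (mul_nonneg (abs_nonneg _) (hk.nonneg _))]
  refine ENNReal.ofReal_le_ofReal (le_of_eq ?_)
  rw [← sq_abs t]
  ring

/-- Since the kernel is symmetric, its first moment over `𝒮` only sees what is missing outside. -/
lemma abs_setIntegral_mul_scaled_le (hk : IsSmoothingFunction k) (hm : MeasurableSet 𝒮)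
    (hγ : 0 < γ) (s : ℝ) :
    |∫ s' in 𝒮, (s' - s) * k ((s' - s) / γ)| ≤ boundaryTail k 𝒮 γ s := by
  have hi := (hk.integrable_mul_scaled hγ).comp_sub_right s
  have h0 : ∫ s', (s' - s) * k ((s' - s) / γ) = 0 := by
    rw [integral_sub_right_eq_self (fun t => t * k (t / γ)) s, hk.integral_mul_scaled]
  have h1 := integral_add_compl hm hi
  rw [h0] at h1
  rw [eq_neg_of_add_eq_zero_left h1, abs_neg, ← Real.norm_eq_abs]
  refine (norm_integral_le_integral_norm _).trans (le_of_eq ?_)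
  rw [← integral_indicator hm.compl, boundaryTail,
    ← integral_add_left_eq_self (𝒮ᶜ.indicator fun s' => ‖(s' - s) * k ((s' - s) / γ)‖) s]
  congr 1
  funext t
  by_cases h : s + t ∈ 𝒮
  · simp [h]
  · simp [h, abs_of_nonneg (hk.nonneg _)]

lemma setIntegral_sq_mul_scaled_le (hk : IsSmoothingFunction k) (hγ : 0 < γ) (s : ℝ) :
    ∫ s' in 𝒮, (s' - s) ^ 2 * k ((s' - s) / γ) ≤ γ ^ 3 * hk.var := by
  rw [← hk.integral_sq_scaled hγ, ← integral_sub_right_eq_self (fun t => t ^ 2 * k (t / γ)) s]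
  exact setIntegral_le_integral ((hk.integrable_sq_scaled hγ).comp_sub_right s)
    (ae_of_all _ fun t => mul_nonneg (sq_nonneg _) (hk.nonneg _))

/-- For a small bandwidth, each half of the kernel has mass at least `γ / 4` within distance `d` of
its centre. -/
lemma quarter_le_setIntegral_scaled (hk : IsSmoothingFunction k) (hγ : 0 < γ) {d : ℝ} (hd : 0 < d)
    (hγd : 2 * hk.var * γ ^ 2 ≤ d ^ 2) :
    γ / 4 ≤ ∫ t in Set.Icc 0 d, k (t / γ) ∧ γ / 4 ≤ ∫ t in Set.Icc (-d) 0, k (t / γ) := by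
  have hi := hk.integrable_scaled hγ
  have hsymm : ∫ t in Set.Icc (-d) 0, k (t / γ) = ∫ t in Set.Icc 0 d, k (t / γ) := by
    rw [← integral_indicator measurableSet_Icc, ← integral_indicator measurableSet_Icc,
      ← integral_neg_eq_self]
    congr 1
    funext t
    by_cases h : t ∈ Set.Icc 0 d
    · have h' : -t ∈ Set.Icc (-d) 0 := ⟨by linarith [h.2], by linarith [h.1]⟩
      rw [Set.indicator_of_mem h, Set.indicator_of_mem h', hk.scaled_neg]
    · rw [Set.indicator_of_notMem h, Set.indicator_of_notMem]
      exact fun h' => h ⟨by linarith [h'.2], by linarith [h'.1]⟩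
  have htail : ∫ t in (Set.Icc (-d) d)ᶜ, k (t / γ) ≤ γ / 2 := by
    calc ∫ t in (Set.Icc (-d) d)ᶜ, k (t / γ)
        ≤ ∫ t in (Set.Icc (-d) d)ᶜ, t ^ 2 * k (t / γ) / d ^ 2 := by
          refine setIntegral_mono_on hi.integrableOn
            ((hk.integrable_sq_scaled hγ).div_const _).integrableOn measurableSet_Icc.compl
            fun t ht => ?_
          rw [le_div_iff₀ (by positivity), mul_comm]
          refine mul_le_mul_of_nonneg_right ?_ (hk.nonneg _)
          by_contra! hlt
          have := abs_lt_of_sq_lt_sq hlt hd.le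
          exact ht ⟨by linarith [(abs_lt.1 this).1], (abs_lt.1 this).2.le⟩
      _ ≤ ∫ t, t ^ 2 * k (t / γ) / d ^ 2 :=
          setIntegral_le_integral ((hk.integrable_sq_scaled hγ).div_const _)
            (ae_of_all _ fun t => div_nonneg (mul_nonneg (sq_nonneg _) (hk.nonneg _)) (sq_nonneg _))
      _ = γ ^ 3 * hk.var / d ^ 2 := by rw [integral_div, hk.integral_sq_scaled hγ]
      _ ≤ γ / 2 := by
          rw [div_le_div_iff₀ (by positivity) two_pos]
          nlinarith
  have htot := integral_add_compl (measurableSet_Icc (a := -d) (b := d)) hi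
  rw [hk.integral_scaled hγ] at htot
  have hle : ∫ t in Set.Icc (-d) d, k (t / γ)
      ≤ (∫ t in Set.Icc (-d) 0, k (t / γ)) + ∫ t in Set.Icc 0 d, k (t / γ) := by
    have hu : Set.Icc (-d) d = Set.Icc (-d) 0 ∪ Set.Ioc 0 d :=
      (Set.Icc_union_Ioc_eq_Icc (by linarith) hd.le).symm
    rw [hu, setIntegral_union (Set.disjoint_left.2 fun x hx hx' => not_lt.2 hx.2 hx'.1)
      measurableSet_Ioc hi.integrableOn hi.integrableOn, integral_Icc_eq_integral_Ioc (x := 0)]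
  constructor <;> linarith

/-- An interval contains a one-sided neighbourhood of fixed length of each of its points, so the
kernel mass inside it is bounded below. -/
lemma quarter_le_setIntegral_interval (hk : IsSmoothingFunction k) (h𝒮 : 𝒮.OrdConnected)
    (hγ : 0 < γ) {a d : ℝ} (hd : 0 < d) (ha : a ∈ 𝒮) (hb : a + 2 * d ∈ 𝒮)
    (hγd : 2 * hk.var * γ ^ 2 ≤ d ^ 2) {s : ℝ} (hs : s ∈ 𝒮) :
    γ / 4 ≤ ∫ s' in 𝒮, k ((s' - s) / γ) := by
  obtain ⟨h1, h2⟩ := quarter_le_setIntegral_scaled hk hγ hd hγd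
  have hm := h𝒮.measurableSet
  have hi := hk.integrable_scaled hγ
  have key : ∀ J : Set ℝ, MeasurableSet J → (∀ t ∈ J, s + t ∈ 𝒮) →
      ∫ t in J, k (t / γ) ≤ ∫ s' in 𝒮, k ((s' - s) / γ) := by
    intro J hJ hsub
    rw [← integral_indicator hJ, ← integral_indicator hm,
      ← integral_add_left_eq_self (𝒮.indicator fun s' => k ((s' - s) / γ)) s]
    refine integral_mono (hi.indicator hJ) ?_ fun t => ?_
    · exact ((hi.comp_sub_right s).indicator hm).comp_add_left s
    · by_cases h : t ∈ J
      · simp [h, hsub t h]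
      · simp only [h, not_false_eq_true, Set.indicator_of_notMem]
        exact Set.indicator_nonneg (fun _ _ => hk.nonneg _) _
  rcases le_total s (a + d) with h | h
  · exact h1.trans (key _ measurableSet_Icc fun t ht => h𝒮.out hs hb
      ⟨by linarith [ht.1], by linarith [ht.2]⟩)
  · exact h2.trans (key _ measurableSet_Icc fun t ht => h𝒮.out ha hs
      ⟨by linarith [ht.1], by linarith [ht.2]⟩)

end Smoothing

/-! ### Taylor expansion of the joint density in `L¹` -/

section Taylor

variable {X : Type*} [MeasurableSpace X]

/-- The derivative in the real parameter of a jointly measurable function is jointly measurable on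
any open set where it exists, as a limit of difference quotients. -/
lemma measurable_indicator_of_hasDerivAt {f f' : X → ℝ → ℝ} {I : Set ℝ}
    (hf : Measurable (Function.uncurry f)) (hI : IsOpen I)
    (hd : ∀ x, ∀ s ∈ I, HasDerivAt (f x) (f' x s) s) :
    Measurable (Function.uncurry fun x => I.indicator (f' x)) := by
  have hu : ∀ n : ℕ, (1 : ℝ) / (n + 1) ≠ 0 := fun n => by positivity
  refine measurable_of_tendsto_metrizable
    (f := fun (n : ℕ) (q : X × ℝ) => (Set.univ ×ˢ I).indicator
      (fun q => (1 / ((n : ℝ) + 1))⁻¹ * (f q.1 (q.2 + 1 / (n + 1)) - f q.1 q.2)) q)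
    (fun n => ?_) (tendsto_pi_nhds.2 fun q => ?_)
  · refine Measurable.indicator ?_ (MeasurableSet.univ.prod hI.measurableSet)
    refine ((hf.comp (measurable_fst.prodMk (measurable_snd.add_const _))).sub hf).const_mul _
  · by_cases hq : q.2 ∈ I
    · have h1 := (hasDerivAt_iff_tendsto_slope_zero.1 (hd q.1 q.2 hq))
      have h2 : Tendsto (fun n : ℕ => (1 : ℝ) / (n + 1)) atTop (𝓝[≠] 0) :=
        tendsto_nhdsWithin_iff.2 ⟨tendsto_one_div_add_atTop_nhds_zero_nat,
          Eventually.of_forall hu⟩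
      have hq' : q ∈ Set.univ ×ˢ I := ⟨trivial, hq⟩
      simpa [Function.uncurry, Function.comp_def, hq, hq'] using h1.comp h2
    · have hq' : q ∉ Set.univ ×ˢ I := fun h => hq h.2
      simp only [Function.uncurry, hq, hq', not_false_eq_true, Set.indicator_of_notMem]
      exact tendsto_const_nhds

/-- A family of functions of a real parameter in the interval `I`, with two derivatives, whose
second derivatives are bounded in the parameter and bounded by `B` in `L¹(μ)`. -/
structure IsSmoothFamily (μ : Measure X) (I : Set ℝ) (B : ℝ) (p p₁ p₂ : X → ℝ → ℝ) : Prop where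
  measurable : Measurable (Function.uncurry p)
  isOpen : IsOpen I
  ordConnected : I.OrdConnected
  hasDerivAt : ∀ x, ∀ s ∈ I, HasDerivAt (p x) (p₁ x s) s
  hasDerivAt' : ∀ x, ∀ s ∈ I, HasDerivAt (p₁ x) (p₂ x s) s
  bounded : ∀ x, ∃ C : ℝ, ∀ s ∈ I, |p₂ x s| ≤ C
  nonneg : 0 ≤ B
  lintegral_le : ∀ s ∈ I, ∫⁻ x, ENNReal.ofReal |p₂ x s| ∂μ ≤ ENNReal.ofReal B

namespace IsSmoothFamily

variable {μ : Measure X} {I : Set ℝ} {B : ℝ} {p p₁ p₂ : X → ℝ → ℝ}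

lemma measurable_deriv (hp : IsSmoothFamily μ I B p p₁ p₂) :
    Measurable (Function.uncurry fun x => I.indicator (p₁ x)) :=
  measurable_indicator_of_hasDerivAt hp.measurable hp.isOpen hp.hasDerivAt

lemma measurable_deriv₂ (hp : IsSmoothFamily μ I B p p₁ p₂) :
    Measurable (Function.uncurry fun x => I.indicator (p₂ x)) := by
  refine measurable_indicator_of_hasDerivAt hp.measurable_deriv hp.isOpen fun x s hs => ?_
  refine (hp.hasDerivAt' x s hs).congr_of_eventuallyEq ?_
  filter_upwards [hp.isOpen.mem_nhds hs] with t ht using Set.indicator_of_mem ht _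

lemma measurable_section (hp : IsSmoothFamily μ I B p p₁ p₂) (s : ℝ) :
    Measurable fun x => p x s := hp.measurable.comp measurable_prodMk_right

lemma measurable_deriv_section (hp : IsSmoothFamily μ I B p p₁ p₂) {s : ℝ} (hs : s ∈ I) :
    Measurable fun x => p₁ x s := by
  have := hp.measurable_deriv.comp (measurable_prodMk_right (y := s))
  simpa [Function.comp_def, Function.uncurry, hs] using this

/-- First-order Taylor expansion at `s`, by the mean value theorem for `p x` and the fundamental
theorem of calculus for its derivative. -/
lemma abs_taylor_le (hp : IsSmoothFamily μ I B p p₁ p₂) {s s' : ℝ} (hs : s ∈ I) (hs' : s' ∈ I)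
    (x : X) :
    ENNReal.ofReal |p x s' - p x s - (s' - s) * p₁ x s| ≤
      ENNReal.ofReal |s' - s| *
        ∫⁻ u in Set.uIoc s s', ENNReal.ofReal |I.indicator (p₂ x) u| := by
  rcases eq_or_ne s s' with rfl | hne
  · simp
  have hsub : Set.uIcc s s' ⊆ I := hp.ordConnected.uIcc_subset hs hs'
  -- a mean value point, whatever the order of `s` and `s'`
  obtain ⟨ξ, hξ, hξe⟩ : ∃ ξ ∈ Set.uIcc s s', p x s' - p x s = (s' - s) * p₁ x ξ := by
    have aux : ∀ a b : ℝ, a < b → Set.Icc a b ⊆ I →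
        ∃ ξ ∈ Set.Icc a b, p x b - p x a = (b - a) * p₁ x ξ := fun a b hab hI => by
      obtain ⟨ξ, hξ, h⟩ := exists_hasDerivAt_eq_slope (p x) (p₁ x) hab
        (fun t ht => (hp.hasDerivAt x t (hI ht)).continuousAt.continuousWithinAt)
        (fun t ht => hp.hasDerivAt x t (hI (Set.Ioo_subset_Icc_self ht)))
      refine ⟨ξ, Set.Ioo_subset_Icc_self hξ, ?_⟩
      have : b - a ≠ 0 := by linarith
      rw [h]
      field_simp
    rcases hne.lt_or_gt with h | h
    · rw [Set.uIcc_of_le h.le] at hsub ⊢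
      exact aux s s' h hsub
    · rw [Set.uIcc_of_ge h.le] at hsub ⊢
      obtain ⟨ξ, hξ, he⟩ := aux s' s h hsub
      exact ⟨ξ, hξ, by linarith⟩
  obtain ⟨C, hC⟩ := hp.bounded x
  have hsubξ : Set.uIcc s ξ ⊆ Set.uIcc s s' := Set.uIcc_subset_uIcc_left hξ
  have hm2 : Measurable (I.indicator (p₂ x)) :=
    hp.measurable_deriv₂.comp measurable_prodMk_left
  have hii : IntervalIntegrable (I.indicator (p₂ x)) volume s ξ := by
    rw [intervalIntegrable_iff]
    refine Measure.integrableOn_of_bounded (M := C) measure_Ioc_lt_top.ne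
      hm2.aestronglyMeasurable ?_
    refine (ae_restrict_iff' measurableSet_uIoc).2 (ae_of_all _ fun u hu => ?_)
    have huI : u ∈ I := hsub (hsubξ (Set.uIoc_subset_uIcc hu))
    rw [Set.indicator_of_mem huI]
    exact hC u huI
  have hftc : ∫ u in s..ξ, I.indicator (p₂ x) u = p₁ x ξ - p₁ x s :=
    intervalIntegral.integral_eq_sub_of_hasDerivAt (fun u hu => by
      rw [Set.indicator_of_mem (hsub (hsubξ hu))]
      exact hp.hasDerivAt' x u (hsub (hsubξ hu))) hii
  have hdiff : ENNReal.ofReal |p₁ x ξ - p₁ x s| ≤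
      ∫⁻ u in Set.uIoc s s', ENNReal.ofReal |I.indicator (p₂ x) u| := by
    rw [← hftc, ← Real.norm_eq_abs, intervalIntegral.norm_intervalIntegral_eq]
    have h1 : ENNReal.ofReal ‖∫ u in Set.uIoc s ξ, I.indicator (p₂ x) u‖ ≤
        ∫⁻ u in Set.uIoc s ξ, ENNReal.ofReal |I.indicator (p₂ x) u| := by
      rw [ofReal_norm]
      refine (enorm_integral_le_lintegral_enorm _).trans (le_of_eq ?_)
      simp_rw [← ofReal_norm, Real.norm_eq_abs]
    refine h1.trans (lintegral_mono_set ?_)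
    exact Set.uIoc_subset_uIoc_of_uIcc_subset_uIcc hsubξ
  rw [hξe, ← mul_sub, abs_mul, ENNReal.ofReal_mul (abs_nonneg _)]
  exact mul_le_mul_right hdiff _

/-- The Taylor remainder is of second order in `L¹(μ)`. -/
lemma lintegral_taylor_le [SigmaFinite μ] (hp : IsSmoothFamily μ I B p p₁ p₂) {s s' : ℝ}
    (hs : s ∈ I) (hs' : s' ∈ I) :
    ∫⁻ x, ENNReal.ofReal |p x s' - p x s - (s' - s) * p₁ x s| ∂μ
      ≤ ENNReal.ofReal (B * (s' - s) ^ 2) := by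
  have hsub : Set.uIoc s s' ⊆ I := Set.uIoc_subset_uIcc.trans (hp.ordConnected.uIcc_subset hs hs')
  have hm : Measurable (Function.uncurry fun x u => ENNReal.ofReal |I.indicator (p₂ x) u|) :=
    (continuous_abs.measurable.comp hp.measurable_deriv₂).ennreal_ofReal
  calc _ ≤ ∫⁻ x, ENNReal.ofReal |s' - s| *
        (∫⁻ u in Set.uIoc s s', ENNReal.ofReal |I.indicator (p₂ x) u|) ∂μ :=
        lintegral_mono fun x => hp.abs_taylor_le hs hs' x
    _ = ENNReal.ofReal |s' - s| *
        ∫⁻ u in Set.uIoc s s', ∫⁻ x, ENNReal.ofReal |I.indicator (p₂ x) u| ∂μ := by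
        rw [lintegral_const_mul' _ _ ENNReal.ofReal_ne_top,
          lintegral_lintegral_swap hm.aemeasurable]
    _ ≤ ENNReal.ofReal |s' - s| * ∫⁻ _u in Set.uIoc s s', ENNReal.ofReal B := by
        refine mul_le_mul_right (setLIntegral_mono' measurableSet_uIoc fun u hu => ?_) _
        simp only [Set.indicator_of_mem (hsub hu)]
        exact hp.lintegral_le u (hsub hu)
    _ = ENNReal.ofReal (B * (s' - s) ^ 2) := by
        rw [setLIntegral_const, Set.uIoc, Real.volume_Ioc, max_sub_min_eq_abs',
          ← ENNReal.ofReal_mul hp.nonneg, ← ENNReal.ofReal_mul (abs_nonneg _), abs_sub_comm s s',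
          ← sq_abs (s' - s)]
        congr 1
        ring

/-- The first derivative is bounded in `L¹(μ)` as soon as `p` is at two distinct points. -/
lemma lintegral_deriv_le [SigmaFinite μ] (hp : IsSmoothFamily μ I B p p₁ p₂) {s s' : ℝ}
    (hs : s ∈ I) (hs' : s' ∈ I) (hne : s' ≠ s) {U : ℝ} (hU : 0 ≤ U)
    (h : ∫⁻ x, ENNReal.ofReal |p x s| ∂μ ≤ ENNReal.ofReal U)
    (h' : ∫⁻ x, ENNReal.ofReal |p x s'| ∂μ ≤ ENNReal.ofReal U) :
    ∫⁻ x, ENNReal.ofReal |p₁ x s| ∂μ ≤ ENNReal.ofReal (2 * U / |s' - s| + B * |s' - s|) := by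
  have hpos : 0 < |s' - s| := abs_pos.2 (sub_ne_zero.2 hne)
  have hm2 : Measurable fun x => |p x s'| :=
    continuous_abs.measurable.comp (hp.measurable_section s')
  have hm3 : Measurable fun x => |p x s' - p x s - (s' - s) * p₁ x s| :=
    continuous_abs.measurable.comp (((hp.measurable_section s').sub (hp.measurable_section s)).sub
      ((hp.measurable_deriv_section hs).const_mul _))
  have hpt : ∀ x, ENNReal.ofReal |p₁ x s| ≤ ENNReal.ofReal |s' - s|⁻¹ *
      (ENNReal.ofReal |p x s| + ENNReal.ofReal |p x s'|
        + ENNReal.ofReal |p x s' - p x s - (s' - s) * p₁ x s|) := fun x => by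
    rw [← ENNReal.ofReal_add (abs_nonneg _) (abs_nonneg _),
      ← ENNReal.ofReal_add (by positivity) (abs_nonneg _), ← ENNReal.ofReal_mul (by positivity)]
    refine ENNReal.ofReal_le_ofReal ?_
    rw [inv_mul_eq_div, le_div_iff₀ hpos, ← abs_mul]
    have : p₁ x s * (s' - s) = -p x s + p x s' - (p x s' - p x s - (s' - s) * p₁ x s) := by ring
    rw [this]
    refine (abs_sub _ _).trans (add_le_add_left ((abs_add_le _ _).trans ?_) _)
    rw [abs_neg]
  refine (lintegral_mono hpt).trans ?_
  rw [lintegral_const_mul' _ _ ENNReal.ofReal_ne_top,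
    lintegral_add_right _ hm3.ennreal_ofReal, lintegral_add_right _ hm2.ennreal_ofReal]
  refine (mul_le_mul_right (add_le_add (add_le_add h h') (hp.lintegral_taylor_le hs hs')) _).trans
    (le_of_eq ?_)
  have hB := hp.nonneg
  rw [← ENNReal.ofReal_add hU hU, ← ENNReal.ofReal_add (by positivity) (by positivity),
    ← ENNReal.ofReal_mul (by positivity), ← sq_abs (s' - s)]
  congr 1
  field_simp
  ring

end IsSmoothFamily

end Taylor

/-! ### The conditional law of `X` given `S` -/

section Disintegration

variable {X : Type*} [MeasurableSpace X]

/-- A joint density `p` and a bounded marginal density `pS` of a law `P` on `X × ℝ`. -/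
structure HasDensities (P : Measure (X × ℝ)) (μ : Measure X) (𝒮 : Set ℝ) (p : X → ℝ → ℝ)
    (pS : ℝ → ℝ) (Lp Up : ℝ) : Prop where
  ordConnected : 𝒮.OrdConnected
  measurable : Measurable (Function.uncurry p)
  measurable' : Measurable pS
  nonneg : ∀ x, ∀ s ∈ 𝒮, 0 ≤ p x s
  eq_withDensity : P = (μ.prod (volume.restrict 𝒮)).withDensity
    fun ω => ENNReal.ofReal (p ω.1 ω.2)
  map_snd_eq : P.map Prod.snd = (volume.restrict 𝒮).withDensity fun s => ENNReal.ofReal (pS s)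
  pos : 0 < Lp
  bounds : ∀ s ∈ 𝒮, Lp < pS s ∧ pS s < Up

/-- The interior points of `𝒮` at which the marginal of the joint density is the marginal
density. -/
def regularPoints (μ : Measure X) (𝒮 : Set ℝ) (p : X → ℝ → ℝ) (pS : ℝ → ℝ) : Set ℝ :=
  {s | s ∈ interior 𝒮 ∧ ∫⁻ x, ENNReal.ofReal (p x s) ∂μ = ENNReal.ofReal (pS s)}

/-- Densities of total mass one are the densities of a Markov kernel, which is completed by a
constant at the other parameters. -/
lemma exists_markovKernel (μ : Measure X) [SigmaFinite μ] (Q : Measure X) [IsProbabilityMeasure Q]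
    {f : ℝ → X → ℝ≥0∞} (hf : Measurable (Function.uncurry f)) :
    ∃ κ : Kernel ℝ X, IsMarkovKernel κ ∧
      ∀ s, ∫⁻ x, f s x ∂μ = 1 → κ s = μ.withDensity (f s) := by
  classical
  have hm : MeasurableSet {s | ∫⁻ x, f s x ∂μ = 1} :=
    hf.lintegral_prod_right' (measurableSet_singleton 1)
  have happ : ∀ s, ∫⁻ x, f s x ∂μ = 1 → Kernel.piecewise hm
      (Kernel.withDensity (Kernel.const ℝ μ) f) (Kernel.const ℝ Q) s = μ.withDensity (f s) :=
    fun s hs => by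
      rw [Kernel.piecewise_apply, if_pos (by simpa using hs), Kernel.withDensity_apply _ hf,
        Kernel.const_apply]
  refine ⟨_, ⟨fun s => ?_⟩, happ⟩
  by_cases hs : ∫⁻ x, f s x ∂μ = 1
  · rw [happ s hs]
    exact ⟨by rw [withDensity_apply _ MeasurableSet.univ, setLIntegral_univ, hs]⟩
  · rw [Kernel.piecewise_apply, if_neg (by simpa using hs), Kernel.const_apply]
    infer_instance

namespace HasDensities

variable {P : Measure (X × ℝ)} {μ : Measure X} {𝒮 : Set ℝ} {p : X → ℝ → ℝ}
  {pS : ℝ → ℝ} {Lp Up : ℝ}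

lemma mem_of_regular {s : ℝ} (hs : s ∈ regularPoints μ 𝒮 p pS) : s ∈ 𝒮 := interior_subset hs.1

lemma integrable_section (h : HasDensities P μ 𝒮 p pS Lp Up) {s : ℝ}
    (hs : s ∈ regularPoints μ 𝒮 p pS) : Integrable (fun x => p x s) μ := by
  refine ⟨(h.measurable.comp measurable_prodMk_right).aestronglyMeasurable, ?_⟩
  rw [hasFiniteIntegral_iff_ofReal (ae_of_all _ fun x => h.nonneg x s (mem_of_regular hs)), hs.2]
  exact ENNReal.ofReal_lt_top

lemma integral_section (h : HasDensities P μ 𝒮 p pS Lp Up) {s : ℝ}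
    (hs : s ∈ regularPoints μ 𝒮 p pS) : ∫ x, p x s ∂μ = pS s := by
  rw [integral_eq_lintegral_of_nonneg_ae (ae_of_all _ fun x => h.nonneg x s (mem_of_regular hs))
    (h.integrable_section hs).1, hs.2,
    ENNReal.toReal_ofReal (h.pos.trans (h.bounds s (mem_of_regular hs)).1).le]

lemma mul_integral_kernel (h : HasDensities P μ 𝒮 p pS Lp Up) {κ : Kernel ℝ X} {s : ℝ}
    (hs : s ∈ regularPoints μ 𝒮 p pS)
    (hκ : κ s = μ.withDensity fun x => ENNReal.ofReal (p x s) * (ENNReal.ofReal (pS s))⁻¹)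
    (f : X → ℝ) : pS s * ∫ x, f x ∂κ s = ∫ x, f x * p x s ∂μ := by
  have hpos := h.pos.trans (h.bounds s (mem_of_regular hs)).1
  have hm : Measurable fun x => ENNReal.ofReal (p x s) * (ENNReal.ofReal (pS s))⁻¹ :=
    (h.measurable.comp measurable_prodMk_right).ennreal_ofReal.mul_const _
  rw [hκ, integral_withDensity_eq_integral_toReal_smul hm (ae_of_all _ fun x =>
    ENNReal.mul_lt_top ENNReal.ofReal_lt_top (by simpa using hpos)), ← integral_const_mul]
  refine integral_congr_ae (ae_of_all _ fun x => ?_)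
  have := h.nonneg x s (mem_of_regular hs)
  simp only [ENNReal.toReal_mul, ENNReal.toReal_inv, smul_eq_mul, ENNReal.toReal_ofReal this,
    ENNReal.toReal_ofReal hpos.le]
  field_simp

/-- Integration against the law of `S`. -/
lemma integral_map_snd (h : HasDensities P μ 𝒮 p pS Lp Up) (g : ℝ → ℝ) :
    ∫ s, g s ∂(P.map Prod.snd) = ∫ s in 𝒮, pS s * g s := by
  rw [h.map_snd_eq, integral_withDensity_eq_integral_toReal_smul h.measurable'.ennreal_ofReal
    (ae_of_all _ fun _ => ENNReal.ofReal_lt_top)]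
  refine setIntegral_congr_fun h.ordConnected.measurableSet fun s hs => ?_
  simp only [smul_eq_mul, ENNReal.toReal_ofReal (h.pos.trans (h.bounds s hs).1).le]

/-- Since the marginal density is bounded below, the interval `𝒮` is bounded. -/
lemma abs_sub_le [IsProbabilityMeasure P] (h : HasDensities P μ 𝒮 p pS Lp Up) {s s' : ℝ}
    (hs : s ∈ 𝒮) (hs' : s' ∈ 𝒮) : |s' - s| ≤ 1 / Lp := by
  have hsub : Set.uIcc s s' ⊆ 𝒮 := h.ordConnected.uIcc_subset hs hs'
  have hprob : IsProbabilityMeasure (P.map Prod.snd) :=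
    Measure.isProbabilityMeasure_map measurable_snd.aemeasurable
  have h1 : ENNReal.ofReal Lp * ENNReal.ofReal |s' - s| ≤ 1 := by
    calc ENNReal.ofReal Lp * ENNReal.ofReal |s' - s|
        = ∫⁻ _u in Set.uIcc s s', ENNReal.ofReal Lp := by
          rw [setLIntegral_const, Set.uIcc, Real.volume_Icc, max_sub_min_eq_abs]
      _ ≤ ∫⁻ u in Set.uIcc s s', ENNReal.ofReal (pS u) :=
          setLIntegral_mono' measurableSet_uIcc fun u hu =>
            ENNReal.ofReal_le_ofReal (h.bounds u (hsub hu)).1.le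
      _ ≤ ∫⁻ u in 𝒮, ENNReal.ofReal (pS u) := lintegral_mono_set hsub
      _ = (P.map Prod.snd) Set.univ := by
          rw [h.map_snd_eq, withDensity_apply _ MeasurableSet.univ, setLIntegral_univ]
      _ = 1 := measure_univ
  rw [← ENNReal.ofReal_mul h.pos.le, ← ENNReal.ofReal_one,
    ENNReal.ofReal_le_ofReal_iff zero_le_one] at h1
  rw [le_div_iff₀ h.pos]
  linarith

variable [SigmaFinite μ]

lemma lintegral_eq (h : HasDensities P μ 𝒮 p pS Lp Up) {g : ℝ × X → ℝ≥0∞} (hg : Measurable g) :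
    ∫⁻ ω, g ω.swap ∂P = ∫⁻ s in 𝒮, ∫⁻ x, ENNReal.ofReal (p x s) * g (s, x) ∂μ := by
  have hp : Measurable fun ω : X × ℝ => ENNReal.ofReal (p ω.1 ω.2) :=
    h.measurable.ennreal_ofReal
  have hg' : Measurable fun ω : X × ℝ => g ω.swap := hg.comp measurable_swap
  rw [h.eq_withDensity, lintegral_withDensity_eq_lintegral_mul _ hp hg',
    lintegral_prod_symm _ (hp.mul hg').aemeasurable]
  rfl

lemma ae_regular (h : HasDensities P μ 𝒮 p pS Lp Up) :
    ∀ᵐ s ∂(volume.restrict 𝒮), s ∈ regularPoints μ 𝒮 p pS := by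
  have hm := h.ordConnected.measurableSet
  have hq : Measurable fun s => ∫⁻ x, ENNReal.ofReal (p x s) ∂μ :=
    Measurable.lintegral_prod_left' (f := fun q : X × ℝ => ENNReal.ofReal (p q.1 q.2))
      h.measurable.ennreal_ofReal
  have h1 : (volume.restrict 𝒮).withDensity (fun s => ∫⁻ x, ENNReal.ofReal (p x s) ∂μ)
      = (volume.restrict 𝒮).withDensity fun s => ENNReal.ofReal (pS s) := by
    rw [← h.map_snd_eq]
    ext A hA
    rw [withDensity_apply _ hA, Measure.map_apply measurable_snd hA,
      ← lintegral_indicator_one (measurable_snd hA)]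
    have h2 := h.lintegral_eq (g := fun q => A.indicator 1 q.1)
      ((measurable_one.indicator hA).comp measurable_fst)
    rw [← lintegral_indicator hA]
    refine Eq.trans ?_ h2.symm
    refine lintegral_congr fun s => ?_
    by_cases hs : s ∈ A <;> simp [hs]
  have h2 := (withDensity_eq_iff_of_sigmaFinite hq.aemeasurable
    h.measurable'.ennreal_ofReal.aemeasurable).1 h1
  have h3 : ∀ᵐ s ∂(volume.restrict 𝒮), s ∈ interior 𝒮 := by
    have h4 : volume (frontier 𝒮) = 0 := h.ordConnected.convex.addHaar_frontier volume
    refine (ae_restrict_iff' hm).2 ?_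
    filter_upwards [compl_mem_ae_iff.2 h4] with s hs hs'
    by_contra hint
    exact hs ⟨subset_closure hs', hint⟩
  filter_upwards [h2, h3] with s hs hs' using ⟨hs', hs⟩

lemma ae_map_snd_regular (h : HasDensities P μ 𝒮 p pS Lp Up) :
    ∀ᵐ s ∂(P.map Prod.snd), s ∈ regularPoints μ 𝒮 p pS := by
  rw [h.map_snd_eq]
  exact (withDensity_absolutelyContinuous _ _).ae_le h.ae_regular

/-- The conditional law of `X` given `S = s` has density `p(x, s) / p(s)`. -/
lemma exists_kernel [IsProbabilityMeasure P] (h : HasDensities P μ 𝒮 p pS Lp Up) :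
    ∃ κ : Kernel ℝ X, IsMarkovKernel κ ∧ P.map Prod.swap = (P.map Prod.snd) ⊗ₘ κ ∧
      ∀ s ∈ regularPoints μ 𝒮 p pS, κ s = μ.withDensity
        fun x => ENNReal.ofReal (p x s) * (ENNReal.ofReal (pS s))⁻¹ := by
  have hf : Measurable (Function.uncurry fun s x =>
      ENNReal.ofReal (p x s) * (ENNReal.ofReal (pS s))⁻¹) :=
    (h.measurable.comp measurable_swap).ennreal_ofReal.mul
      (h.measurable'.comp measurable_fst).ennreal_ofReal.inv
  have : IsProbabilityMeasure (P.map Prod.fst) :=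
    Measure.isProbabilityMeasure_map measurable_fst.aemeasurable
  have : IsProbabilityMeasure (P.map Prod.snd) :=
    Measure.isProbabilityMeasure_map measurable_snd.aemeasurable
  obtain ⟨κ, hκ, hκs⟩ := exists_markovKernel μ (P.map Prod.fst) hf
  have hpos : ∀ s ∈ regularPoints μ 𝒮 p pS, ENNReal.ofReal (pS s) ≠ 0 := fun s hs => by
    simpa using h.pos.trans (h.bounds s (mem_of_regular hs)).1
  have hκ' : ∀ s ∈ regularPoints μ 𝒮 p pS, κ s = μ.withDensity
      fun x => ENNReal.ofReal (p x s) * (ENNReal.ofReal (pS s))⁻¹ := fun s hs => by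
    refine hκs s ?_
    have hm : Measurable fun x => ENNReal.ofReal (p x s) :=
      (h.measurable.comp measurable_prodMk_right).ennreal_ofReal
    rw [lintegral_mul_const _ hm, hs.2, ENNReal.mul_inv_cancel (hpos s hs) ENNReal.ofReal_ne_top]
  refine ⟨κ, hκ, ?_, hκ'⟩
  refine Measure.ext_of_lintegral _ fun g hg => ?_
  rw [lintegral_map hg measurable_swap, Measure.lintegral_compProd hg, h.lintegral_eq hg,
    h.map_snd_eq, lintegral_withDensity_eq_lintegral_mul _ h.measurable'.ennreal_ofReal
      (hg.lintegral_kernel_prod_right')]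
  refine lintegral_congr_ae ?_
  filter_upwards [h.ae_regular] with s hs
  have hm : Measurable fun x => ENNReal.ofReal (p x s) * (ENNReal.ofReal (pS s))⁻¹ :=
    hf.comp measurable_prodMk_left
  have hgm : Measurable fun x => g (s, x) := hg.comp measurable_prodMk_left
  rw [Pi.mul_apply, hκ' s hs, lintegral_withDensity_eq_lintegral_mul _ hm hgm,
    ← lintegral_const_mul _ (hm.mul hgm)]
  refine lintegral_congr fun x => ?_
  simp only [Pi.mul_apply]
  calc ENNReal.ofReal (p x s) * g (s, x)
      = ENNReal.ofReal (pS s) * (ENNReal.ofReal (pS s))⁻¹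
          * (ENNReal.ofReal (p x s) * g (s, x)) := by
        rw [ENNReal.mul_inv_cancel (hpos s hs) ENNReal.ofReal_ne_top, one_mul]
    _ = _ := by ring

/-- Two distinct regular points exist, because `S` has no atoms. -/
lemma exists_regular_lt [IsProbabilityMeasure P] (h : HasDensities P μ 𝒮 p pS Lp Up) :
    ∃ a ∈ regularPoints μ 𝒮 p pS, ∃ b ∈ regularPoints μ 𝒮 p pS, a < b := by
  have hinf : ¬ (regularPoints μ 𝒮 p pS).Subsingleton := fun hsub => by
    have h0 : volume (regularPoints μ 𝒮 p pS) = 0 := hsub.measure_zero volume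
    have h1 : volume 𝒮 = 0 := by
      have h2 := h.ae_regular
      rw [ae_restrict_iff' h.ordConnected.measurableSet] at h2
      refine measure_mono_null (fun s hs => ?_) (measure_union_null h0 (mem_ae_iff.1 h2))
      by_cases hr : s ∈ regularPoints μ 𝒮 p pS
      · exact Or.inl hr
      · exact Or.inr fun hc => hr (hc hs)
    have h3 : (P.map Prod.snd) Set.univ = 0 := by
      rw [h.map_snd_eq, Measure.restrict_eq_zero.2 h1]
      simp
    rw [Measure.map_apply measurable_snd MeasurableSet.univ] at h3
    simp at h3
  rw [Set.not_subsingleton_iff] at hinf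
  obtain ⟨a, ha, b, hb, hab⟩ := hinf
  rcases hab.lt_or_gt with hlt | hlt
  · exact ⟨a, ha, b, hb, hlt⟩
  · exact ⟨b, hb, a, ha, hlt⟩

end HasDensities

end Disintegration

/-! ### Bias and variance of the kernel estimator -/

section Bias

variable {X : Type*} [MeasurableSpace X]

lemma integrable_of_lintegral_abs_le {μ : Measure X} {g : X → ℝ} {c : ℝ}
    (hg : Measurable g) (h : ∫⁻ x, ENNReal.ofReal |g x| ∂μ ≤ ENNReal.ofReal c) :
    Integrable g μ := by
  refine ⟨hg.aestronglyMeasurable, ?_⟩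
  rw [hasFiniteIntegral_iff_norm]
  exact h.trans_lt ENNReal.ofReal_lt_top

lemma abs_integral_mul_le {μ : Measure X} {f g : X → ℝ} {c C : ℝ} (hc : 0 ≤ c)
    (hC : 0 ≤ C) (hf : ∀ x, |f x| ≤ C) (hg : Measurable g)
    (h : ∫⁻ x, ENNReal.ofReal |g x| ∂μ ≤ ENNReal.ofReal c) :
    |∫ x, f x * g x ∂μ| ≤ C * c := by
  have hgi := integrable_of_lintegral_abs_le hg h
  have h1 : ∫ x, |g x| ∂μ ≤ c := by
    rw [integral_eq_lintegral_of_nonneg_ae (ae_of_all _ fun x => abs_nonneg _) hgi.abs.1]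
    exact ENNReal.toReal_le_of_le_ofReal hc h
  have h2 := norm_integral_le_of_norm_le (f := fun x => f x * g x) (hgi.abs.const_mul C)
    (ae_of_all _ fun x => by
      rw [Real.norm_eq_abs, abs_mul]
      exact mul_le_mul_of_nonneg_right (hf x) (abs_nonneg _))
  rw [integral_const_mul] at h2
  exact h2.trans (mul_le_mul_of_nonneg_left h1 hC)

namespace HasDensities

variable {P : Measure (X × ℝ)} {μ : Measure X} {𝒮 : Set ℝ} {p p₁ p₂ : X → ℝ → ℝ} {pS : ℝ → ℝ}
  {Lp Up B : ℝ} {k : ℝ → ℝ} {γ : ℝ}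

lemma lintegral_abs_section (h : HasDensities P μ 𝒮 p pS Lp Up) {s : ℝ}
    (hs : s ∈ regularPoints μ 𝒮 p pS) :
    ∫⁻ x, ENNReal.ofReal |p x s| ∂μ ≤ ENNReal.ofReal Up := by
  calc ∫⁻ x, ENNReal.ofReal |p x s| ∂μ = ∫⁻ x, ENNReal.ofReal (p x s) ∂μ :=
        lintegral_congr fun x => by rw [abs_of_nonneg (h.nonneg x s (mem_of_regular hs))]
    _ = ENNReal.ofReal (pS s) := hs.2
    _ ≤ _ := ENNReal.ofReal_le_ofReal (h.bounds s (mem_of_regular hs)).2.le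

lemma ae_abs_density_le (h : HasDensities P μ 𝒮 p pS Lp Up) :
    ∀ᵐ s ∂(volume.restrict 𝒮), ‖pS s‖ ≤ Up := by
  refine (ae_restrict_iff' h.ordConnected.measurableSet).2 (ae_of_all _ fun s hs => ?_)
  have := h.bounds s hs
  rw [Real.norm_eq_abs, abs_of_pos (h.pos.trans this.1)]
  exact this.2.le

lemma integrableOn_scaled (hk : IsSmoothingFunction k) (hγ : 0 < γ) (s : ℝ) :
    IntegrableOn (fun s' => k ((s' - s) / γ)) 𝒮 :=
  ((hk.integrable_scaled hγ).comp_sub_right s).integrableOn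

lemma integrableOn_density_mul (h : HasDensities P μ 𝒮 p pS Lp Up) (hk : IsSmoothingFunction k)
    (hγ : 0 < γ) (s : ℝ) : IntegrableOn (fun s' => pS s' * k ((s' - s) / γ)) 𝒮 :=
  (integrableOn_scaled hk hγ s).bdd_mul (c := Up) h.measurable'.aestronglyMeasurable
    h.ae_abs_density_le

lemma integral_boundaryTail_le (h : HasDensities P μ 𝒮 p pS Lp Up) (hU : 0 ≤ Up)
    (hk : IsSmoothingFunction k) (hγ : 0 < γ) :
    ∫ s, boundaryTail k 𝒮 γ s ∂(P.map Prod.snd) ≤ Up * (γ ^ 3 * hk.var) := by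
  have hm := measurable_boundaryTail (γ := γ) hk h.ordConnected.measurableSet
  have hv := hk.var_nonneg
  rw [integral_eq_lintegral_of_nonneg_ae (ae_of_all _ fun s => boundaryTail_nonneg hk s)
    hm.aestronglyMeasurable]
  refine ENNReal.toReal_le_of_le_ofReal (by positivity) ?_
  rw [h.map_snd_eq, lintegral_withDensity_eq_lintegral_mul _ h.measurable'.ennreal_ofReal
    hm.ennreal_ofReal, ENNReal.ofReal_mul hU]
  calc _ ≤ ∫⁻ s in 𝒮, ENNReal.ofReal Up * ENNReal.ofReal (boundaryTail k 𝒮 γ s) :=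
        setLIntegral_mono' h.ordConnected.measurableSet fun s hs =>
          mul_le_mul_left (ENNReal.ofReal_le_ofReal (h.bounds s hs).2.le) _
    _ = ENNReal.ofReal Up * ∫⁻ s in 𝒮, ENNReal.ofReal (boundaryTail k 𝒮 γ s) :=
        lintegral_const_mul' _ _ ENNReal.ofReal_ne_top
    _ ≤ _ := mul_le_mul_right (lintegral_boundaryTail_le hk h.ordConnected hγ) _

/-- First-order expansion in `s'` of `p(s') (E[f(X) | S = s'] - E[f(X) | S = s])`. -/
lemma exists_expansion [SigmaFinite μ] (h : HasDensities P μ 𝒮 p pS Lp Up)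
    (hp : IsSmoothFamily μ (interior 𝒮) B p p₁ p₂) {C : ℝ} (hC : 0 ≤ C)
    (hC' : ∀ s ∈ regularPoints μ 𝒮 p pS, ∫⁻ x, ENNReal.ofReal |p₁ x s| ∂μ ≤ ENNReal.ofReal C)
    {κ : Kernel ℝ X} [IsMarkovKernel κ] (hκ : ∀ s ∈ regularPoints μ 𝒮 p pS, κ s = μ.withDensity
      fun x => ENNReal.ofReal (p x s) * (ENNReal.ofReal (pS s))⁻¹)
    {s : ℝ} (hs : s ∈ regularPoints μ 𝒮 p pS) {f : X → ℝ} (hf : Measurable f)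
    (hf1 : ∀ x, |f x| ≤ 1) :
    ∃ a : ℝ, |a| ≤ 2 * C ∧ ∀ s' ∈ regularPoints μ 𝒮 p pS,
      |pS s' * ((∫ x, f x ∂κ s') - ∫ x, f x ∂κ s) - (s' - s) * a| ≤ 2 * (B * (s' - s) ^ 2) := by
  set c : ℝ := ∫ x, f x ∂κ s with hc
  have hc1 : |c| ≤ 1 := abs_integral_le_of_abs_le hf1
  have hfc : ∀ x, |f x - c| ≤ 2 := fun x => (abs_sub _ _).trans (by linarith [hf1 x])
  have hfcm : Measurable fun x => f x - c := hf.sub_const c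
  have hmul : ∀ g : X → ℝ, Integrable g μ → Integrable (fun x => (f x - c) * g x) μ := fun g hg =>
    hg.bdd_mul (c := 2) hfcm.aestronglyMeasurable (ae_of_all _ hfc)
  have hp1 := hp.measurable_deriv_section hs.1
  have hi1 := integrable_of_lintegral_abs_le hp1 (hC' s hs)
  have hrepr : ∀ s' ∈ regularPoints μ 𝒮 p pS,
      pS s' * ((∫ x, f x ∂κ s') - c) = ∫ x, (f x - c) * p x s' ∂μ := by
    intro s' hs'
    have hi := h.integrable_section hs'
    have hfi : Integrable (fun x => f x * p x s') μ :=
      hi.bdd_mul (c := 1) hf.aestronglyMeasurable (ae_of_all _ hf1)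
    simp_rw [sub_mul]
    rw [integral_sub hfi (hi.const_mul c), integral_const_mul, h.integral_section hs',
      ← h.mul_integral_kernel hs' (hκ s' hs')]
    ring
  refine ⟨∫ x, (f x - c) * p₁ x s ∂μ,
    abs_integral_mul_le hC zero_le_two hfc hp1 (hC' s hs), fun s' hs' => ?_⟩
  have h0 : ∫ x, (f x - c) * p x s ∂μ = 0 := by
    rw [← hrepr s hs, ← hc, sub_self, mul_zero]
  have heq : pS s' * ((∫ x, f x ∂κ s') - c) - (s' - s) * ∫ x, (f x - c) * p₁ x s ∂μ
      = ∫ x, (f x - c) * (p x s' - p x s - (s' - s) * p₁ x s) ∂μ := by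
    have hpt : ∀ x, (f x - c) * (p x s' - p x s - (s' - s) * p₁ x s)
        = ((f x - c) * p x s' - (f x - c) * p x s) - (s' - s) * ((f x - c) * p₁ x s) :=
      fun x => by ring
    simp_rw [hpt]
    have e1 := hmul _ (h.integrable_section hs')
    have e2 := hmul _ (h.integrable_section hs)
    have e3 := (hmul _ hi1).const_mul (s' - s)
    have e12 : Integrable (fun x => (f x - c) * p x s' - (f x - c) * p x s) μ := e1.sub e2
    rw [integral_sub e12 e3, integral_sub e1 e2, h0, sub_zero, integral_const_mul,
      hrepr s' hs']
  rw [heq]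
  have hB := hp.nonneg
  exact abs_integral_mul_le (by positivity) zero_le_two hfc
    (((hp.measurable_section s').sub (hp.measurable_section s)).sub (hp1.const_mul _))
    (hp.lintegral_taylor_le hs.1 hs'.1)

variable [IsProbabilityMeasure P]

lemma integral_scaled_mul (h : HasDensities P μ 𝒮 p pS Lp Up) (hk : IsSmoothingFunction k)
    {κ : Kernel ℝ X} [IsMarkovKernel κ] (hκ : P.map Prod.swap = (P.map Prod.snd) ⊗ₘ κ) (s : ℝ)
    {f : X → ℝ} (hf : Measurable f) (hf1 : ∀ x, |f x| ≤ 1) :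
    ∫ ω, k ((ω.2 - s) / γ) * f ω.1 ∂P
      = ∫ s' in 𝒮, pS s' * (k ((s' - s) / γ) * ∫ x, f x ∂κ s') := by
  obtain ⟨M, hM⟩ := hk.bounded
  have hkm : Measurable fun s' => k ((s' - s) / γ) :=
    hk.measurable.comp ((measurable_id.sub_const s).div_const γ)
  have hm : Measurable fun q : ℝ × X => k ((q.1 - s) / γ) * f q.2 :=
    (hkm.comp measurable_fst).mul (hf.comp measurable_snd)
  have hprob : IsProbabilityMeasure (P.map Prod.snd) :=
    Measure.isProbabilityMeasure_map measurable_snd.aemeasurable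
  have h1 : ∫ ω, k ((ω.2 - s) / γ) * f ω.1 ∂P
      = ∫ q, k ((q.1 - s) / γ) * f q.2 ∂(P.map Prod.swap) := by
    rw [integral_map measurable_swap.aemeasurable hm.aestronglyMeasurable]
    rfl
  have hi : Integrable (fun q : ℝ × X => k ((q.1 - s) / γ) * f q.2) ((P.map Prod.snd) ⊗ₘ κ) := by
    refine integrable_of_abs_le (c := M) hm fun q => ?_
    rw [abs_mul, abs_of_nonneg (hk.nonneg _)]
    exact (mul_le_of_le_one_right (hk.nonneg _) (hf1 _)).trans (hM _)
  rw [h1, hκ, Measure.integral_compProd hi, h.integral_map_snd]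
  simp_rw [integral_const_mul]

lemma integral_scaled (h : HasDensities P μ 𝒮 p pS Lp Up) (hk : IsSmoothingFunction k)
    {κ : Kernel ℝ X} [IsMarkovKernel κ] (hκ : P.map Prod.swap = (P.map Prod.snd) ⊗ₘ κ) (s : ℝ) :
    ∫ ω, k ((ω.2 - s) / γ) ∂P = ∫ s' in 𝒮, pS s' * k ((s' - s) / γ) := by
  have := h.integral_scaled_mul (γ := γ) hk hκ s (f := fun _ => 1) measurable_const (by simp)
  simpa using this

lemma integral_scaled_le (h : HasDensities P μ 𝒮 p pS Lp Up) (hk : IsSmoothingFunction k)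
    {κ : Kernel ℝ X} [IsMarkovKernel κ] (hκ : P.map Prod.swap = (P.map Prod.snd) ⊗ₘ κ)
    (hU : 0 ≤ Up) (hγ : 0 < γ) (s : ℝ) : ∫ ω, k ((ω.2 - s) / γ) ∂P ≤ Up * γ := by
  rw [h.integral_scaled hk hκ]
  calc ∫ s' in 𝒮, pS s' * k ((s' - s) / γ) ≤ ∫ s' in 𝒮, Up * k ((s' - s) / γ) :=
        setIntegral_mono_on (h.integrableOn_density_mul hk hγ s)
          ((integrableOn_scaled hk hγ s).const_mul _) h.ordConnected.measurableSet
          fun s' hs' => mul_le_mul_of_nonneg_right (h.bounds s' hs').2.le (hk.nonneg _)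
    _ = Up * ∫ s' in 𝒮, k ((s' - s) / γ) := integral_const_mul _ _
    _ ≤ Up * ∫ s', k ((s' - s) / γ) :=
        mul_le_mul_of_nonneg_left (setIntegral_le_integral
          ((hk.integrable_scaled hγ).comp_sub_right s) (ae_of_all _ fun _ => hk.nonneg _)) hU
    _ = Up * γ := by
        rw [integral_sub_right_eq_self (fun t => k (t / γ)) s, hk.integral_scaled hγ]

lemma integral_scaled_ge (h : HasDensities P μ 𝒮 p pS Lp Up) (hk : IsSmoothingFunction k)
    {κ : Kernel ℝ X} [IsMarkovKernel κ] (hκ : P.map Prod.swap = (P.map Prod.snd) ⊗ₘ κ)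
    (hγ : 0 < γ) {a d : ℝ} (hd : 0 < d) (ha : a ∈ 𝒮) (hb : a + 2 * d ∈ 𝒮)
    (hγd : 2 * hk.var * γ ^ 2 ≤ d ^ 2) {s : ℝ} (hs : s ∈ 𝒮) :
    Lp / 4 * γ ≤ ∫ ω, k ((ω.2 - s) / γ) ∂P := by
  rw [h.integral_scaled hk hκ]
  calc Lp / 4 * γ = Lp * (γ / 4) := by ring
    _ ≤ Lp * ∫ s' in 𝒮, k ((s' - s) / γ) := mul_le_mul_of_nonneg_left
        (quarter_le_setIntegral_interval hk h.ordConnected hγ hd ha hb hγd hs) h.pos.le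
    _ = ∫ s' in 𝒮, Lp * k ((s' - s) / γ) := (integral_const_mul _ _).symm
    _ ≤ ∫ s' in 𝒮, pS s' * k ((s' - s) / γ) :=
        setIntegral_mono_on ((integrableOn_scaled hk hγ s).const_mul _)
          (h.integrableOn_density_mul hk hγ s) h.ordConnected.measurableSet
          fun s' hs' => mul_le_mul_of_nonneg_right (h.bounds s' hs').1.le (hk.nonneg _)

variable [SigmaFinite μ]

/-- The `L¹` bound on the first derivative, uniform over the regular points: one of two fixed
regular points is at a distance bounded below. -/
lemma exists_lintegral_deriv_le (h : HasDensities P μ 𝒮 p pS Lp Up)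
    (hp : IsSmoothFamily μ (interior 𝒮) B p p₁ p₂) :
    ∃ C, 0 ≤ C ∧ ∀ s ∈ regularPoints μ 𝒮 p pS,
      ∫⁻ x, ENNReal.ofReal |p₁ x s| ∂μ ≤ ENNReal.ofReal C := by
  obtain ⟨a, ha, b, hb, hab⟩ := h.exists_regular_lt
  have hU : 0 ≤ Up := by
    have := h.bounds a (mem_of_regular ha)
    linarith [h.pos]
  have hB := hp.nonneg
  have hL := h.pos
  have hd : 0 < (b - a) / 2 := by linarith
  refine ⟨2 * Up / ((b - a) / 2) + B * (1 / Lp), by positivity, fun s hs => ?_⟩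
  have key : ∀ s' ∈ regularPoints μ 𝒮 p pS, (b - a) / 2 ≤ |s' - s| →
      ∫⁻ x, ENNReal.ofReal |p₁ x s| ∂μ
        ≤ ENNReal.ofReal (2 * Up / ((b - a) / 2) + B * (1 / Lp)) := by
    intro s' hs' hd'
    have hne : s' ≠ s := fun he => by
      rw [he, sub_self, abs_zero] at hd'
      linarith
    refine (hp.lintegral_deriv_le hs.1 hs'.1 hne hU (h.lintegral_abs_section hs)
      (h.lintegral_abs_section hs')).trans (ENNReal.ofReal_le_ofReal ?_)
    gcongr
    exact h.abs_sub_le (mem_of_regular hs) (mem_of_regular hs')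
  rcases le_total s ((a + b) / 2) with hle | hle
  · exact key b hb (by rw [le_abs]; left; linarith)
  · exact key a ha (by rw [le_abs]; right; linarith)

/-- The bias of the unnormalised kernel estimator. The linear term of the expansion is multiplied
by the first moment of the kernel over `𝒮`, which is a pure boundary effect. -/
lemma abs_bias_le (h : HasDensities P μ 𝒮 p pS Lp Up)
    (hp : IsSmoothFamily μ (interior 𝒮) B p p₁ p₂) {C : ℝ} (hC : 0 ≤ C)
    (hC' : ∀ s ∈ regularPoints μ 𝒮 p pS, ∫⁻ x, ENNReal.ofReal |p₁ x s| ∂μ ≤ ENNReal.ofReal C)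
    (hk : IsSmoothingFunction k) (hγ : 0 < γ)
    {κ : Kernel ℝ X} [IsMarkovKernel κ] (hκ : P.map Prod.swap = (P.map Prod.snd) ⊗ₘ κ)
    (hκ' : ∀ s ∈ regularPoints μ 𝒮 p pS, κ s = μ.withDensity
      fun x => ENNReal.ofReal (p x s) * (ENNReal.ofReal (pS s))⁻¹)
    {s : ℝ} (hs : s ∈ regularPoints μ 𝒮 p pS) {f : X → ℝ} (hf : Measurable f)
    (hf1 : ∀ x, |f x| ≤ 1) :
    |(∫ ω, k ((ω.2 - s) / γ) * f ω.1 ∂P) - (∫ x, f x ∂κ s) * ∫ ω, k ((ω.2 - s) / γ) ∂P|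
      ≤ 2 * C * boundaryTail k 𝒮 γ s + 2 * B * (γ ^ 3 * hk.var) := by
  have hS := h.ordConnected.measurableSet
  have hB := hp.nonneg
  obtain ⟨a, ha, hexp⟩ := h.exists_expansion hp hC hC' hκ' hs hf hf1
  set c : ℝ := ∫ x, f x ∂κ s with hc
  have hmm : Measurable fun s' => ∫ x, f x ∂κ s' :=
    (StronglyMeasurable.integral_kernel_prod_right' (κ := κ)
      (f := fun q : ℝ × X => f q.2) (hf.comp measurable_snd).stronglyMeasurable).measurable
  have hi := h.integrableOn_density_mul hk hγ s
  have hi1 : IntegrableOn (fun s' => pS s' * (k ((s' - s) / γ) * ∫ x, f x ∂κ s')) 𝒮 := by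
    have := hi.bdd_mul (c := 1) (hmm.aestronglyMeasurable (μ := volume.restrict 𝒮))
      (ae_of_all _ fun s' => abs_integral_le_of_abs_le hf1)
    refine this.congr (ae_of_all _ fun s' => ?_)
    dsimp only
    ring
  have hlin : IntegrableOn (fun s' => (s' - s) * k ((s' - s) / γ)) 𝒮 :=
    ((hk.integrable_mul_scaled hγ).comp_sub_right s).integrableOn
  have hsq : IntegrableOn (fun s' => (s' - s) ^ 2 * k ((s' - s) / γ)) 𝒮 :=
    ((hk.integrable_sq_scaled hγ).comp_sub_right s).integrableOn
  have heq : (∫ ω, k ((ω.2 - s) / γ) * f ω.1 ∂P) - c * ∫ ω, k ((ω.2 - s) / γ) ∂P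
      = (∫ s' in 𝒮, k ((s' - s) / γ) *
          (pS s' * ((∫ x, f x ∂κ s') - c) - (s' - s) * a))
        + a * ∫ s' in 𝒮, (s' - s) * k ((s' - s) / γ) := by
    have e1 : IntegrableOn (fun s' => pS s' * (k ((s' - s) / γ) * ∫ x, f x ∂κ s')
        - c * (pS s' * k ((s' - s) / γ))) 𝒮 := hi1.sub (hi.const_mul c)
    rw [h.integral_scaled_mul hk hκ s hf hf1, h.integral_scaled hk hκ, ← integral_const_mul,
      ← integral_const_mul, ← integral_sub hi1 (hi.const_mul c), ← sub_eq_iff_eq_add,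
      ← integral_sub e1 (hlin.const_mul a)]
    refine integral_congr_ae (ae_of_all _ fun s' => ?_)
    dsimp only
    ring
  rw [heq]
  refine (abs_add_le _ _).trans ?_
  rw [add_comm]
  refine add_le_add ?_ ?_
  · rw [abs_mul]
    exact mul_le_mul ha (abs_setIntegral_mul_scaled_le hk hS hγ s) (abs_nonneg _) (by positivity)
  · have hle := norm_integral_le_of_norm_le (μ := volume.restrict 𝒮)
      (f := fun s' => k ((s' - s) / γ) * (pS s' * ((∫ x, f x ∂κ s') - c) - (s' - s) * a))
      (hsq.const_mul (2 * B)) (by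
        filter_upwards [h.ae_regular] with s' hs'
        rw [Real.norm_eq_abs, abs_mul, abs_of_nonneg (hk.nonneg _)]
        refine (mul_le_mul_of_nonneg_left (hexp s' hs') (hk.nonneg _)).trans (le_of_eq ?_)
        ring)
    rw [integral_const_mul, Real.norm_eq_abs] at hle
    exact hle.trans (mul_le_mul_of_nonneg_left (setIntegral_sq_mul_scaled_le hk hγ s)
      (by positivity))

end HasDensities

/-- What the concentration argument uses about the kernel estimator with bandwidth `γ`: its variance
is of order `γ`, its denominator is at least of order `γ`, and its relative bias is bounded,
uniformly over test functions, by a function `b` of size `γ` whose mean has size `γ ^ 2`. -/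
structure KernelEstimates (P : Measure (X × ℝ)) (κ : Kernel ℝ X) (k : ℝ → ℝ) (γ C c₀ : ℝ)
    (b : ℝ → ℝ) : Prop where
  integral_sq_le : ∀ (s : ℝ) (f : X → ℝ), Measurable f → (∀ x, |f x| ≤ 1) →
    ∫ ω, (k ((ω.2 - s) / γ) * f ω.1) ^ 2 ∂P ≤ C * γ
  measurable : Measurable b
  nonneg : ∀ s, 0 ≤ b s
  le : ∀ s, b s ≤ C * γ
  integral_le : ∫ s, b s ∂(P.map Prod.snd) ≤ C * γ ^ 2
  ae_bias_le : ∀ᵐ s ∂(P.map Prod.snd), c₀ * γ ≤ ∫ ω, k ((ω.2 - s) / γ) ∂P ∧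
    ∀ f : X → ℝ, Measurable f → (∀ x, |f x| ≤ 1) →
      |(∫ ω, k ((ω.2 - s) / γ) * f ω.1 ∂P) - (∫ x, f x ∂κ s) * ∫ ω, k ((ω.2 - s) / γ) ∂P|
        ≤ (∫ ω, k ((ω.2 - s) / γ) ∂P) * b s

lemma HasDensities.exists_kernelEstimates {P : Measure (X × ℝ)} [IsProbabilityMeasure P]
    {μ : Measure X} [SigmaFinite μ] {𝒮 : Set ℝ} {p p₁ p₂ : X → ℝ → ℝ} {pS : ℝ → ℝ} {Lp Up B : ℝ}
    (h : HasDensities P μ 𝒮 p pS Lp Up) (hp : IsSmoothFamily μ (interior 𝒮) B p p₁ p₂)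
    {k : ℝ → ℝ} (hk : IsSmoothingFunction k) :
    ∃ κ : Kernel ℝ X, IsMarkovKernel κ ∧ P.map Prod.swap = (P.map Prod.snd) ⊗ₘ κ ∧
      ∃ C c₀ γ₀ : ℝ, 0 < C ∧ 0 < c₀ ∧ 0 < γ₀ ∧ ∀ γ, 0 < γ → γ ≤ γ₀ →
        ∃ b, KernelEstimates P κ k γ C c₀ b := by
  obtain ⟨κ, hκ, hdis, hκ'⟩ := h.exists_kernel
  refine ⟨κ, hκ, hdis, ?_⟩
  obtain ⟨D, hD, hD'⟩ := h.exists_lintegral_deriv_le hp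
  obtain ⟨a, ha, b, hb, hab⟩ := h.exists_regular_lt
  obtain ⟨M, hM⟩ := hk.bounded
  have hL := h.pos
  have hB := hp.nonneg
  have hU : 0 ≤ Up := by
    have := h.bounds a (HasDensities.mem_of_regular ha)
    linarith
  have hM0 : 0 ≤ M := (hk.nonneg 0).trans (hM 0)
  have hv := hk.var_nonneg
  have hm1 := hk.absMoment_nonneg
  set d : ℝ := (b - a) / 2 with hd_def
  have hd : 0 < d := by simp only [hd_def]; linarith
  have hb' : a + 2 * d ∈ 𝒮 := by
    have : a + 2 * d = b := by simp only [hd_def]; ring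
    rw [this]
    exact HasDensities.mem_of_regular hb
  have hS := h.ordConnected.measurableSet
  set σ := hk.var
  set m₁ := hk.absMoment
  set C : ℝ := 1 + M * Up + 8 / Lp * (D * m₁ + B * σ) + 8 / Lp * (D * Up * σ + B * σ) with hC
  -- with this choice of `γ₀` at least half of the kernel mass lies within `d` of the centre
  refine ⟨C, Lp / 4, min 1 (d / (1 + 2 * σ)), by positivity, by positivity, by positivity,
    fun γ hγ hγ0 => ?_⟩
  have hγ1 : γ ≤ 1 := hγ0.trans (min_le_left _ _)
  have hγd : 2 * σ * γ ^ 2 ≤ d ^ 2 := by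
    have h1 : γ * (1 + 2 * σ) ≤ d :=
      (le_div_iff₀ (by positivity)).1 (hγ0.trans (min_le_right _ _))
    have h2 := pow_le_pow_left₀ (by positivity) h1 2
    nlinarith [mul_nonneg hv (sq_nonneg γ), mul_nonneg (sq_nonneg σ) (sq_nonneg γ)]
  have hprob : IsProbabilityMeasure (P.map Prod.snd) :=
    Measure.isProbabilityMeasure_map measurable_snd.aemeasurable
  have hTm := measurable_boundaryTail (γ := γ) hk hS
  have hTle := boundaryTail_le hk hS hγ
  have hT0 := boundaryTail_nonneg (𝒮 := 𝒮) (γ := γ) hk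
  have hTi : Integrable (boundaryTail k 𝒮 γ) (P.map Prod.snd) :=
    integrable_of_abs_le hTm fun s => by rw [abs_of_nonneg (hT0 s)]; exact hTle s
  refine ⟨fun s => 8 / (Lp * γ) * (D * boundaryTail k 𝒮 γ s + B * (γ ^ 3 * σ)), ?_, ?_, ?_, ?_, ?_,
    ?_⟩
  · intro s f hf hf1
    have hkm : Measurable fun ω : X × ℝ => k ((ω.2 - s) / γ) :=
      hk.measurable.comp ((measurable_snd.sub_const s).div_const γ)
    have hki : Integrable (fun ω : X × ℝ => k ((ω.2 - s) / γ)) P :=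
      integrable_of_abs_le (c := M) hkm fun ω => by rw [abs_of_nonneg (hk.nonneg _)]; exact hM _
    have hpt : ∀ ω : X × ℝ, (k ((ω.2 - s) / γ) * f ω.1) ^ 2 ≤ M * k ((ω.2 - s) / γ) := fun ω => by
      have h1 : f ω.1 ^ 2 ≤ 1 := (sq_le_one_iff_abs_le_one _).2 (hf1 _)
      have h2 := hk.nonneg ((ω.2 - s) / γ)
      rw [mul_pow]
      calc k ((ω.2 - s) / γ) ^ 2 * f ω.1 ^ 2 ≤ k ((ω.2 - s) / γ) ^ 2 :=
            mul_le_of_le_one_right (sq_nonneg _) h1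
        _ ≤ M * k ((ω.2 - s) / γ) := by
            rw [sq]; exact mul_le_mul_of_nonneg_right (hM _) h2
    calc ∫ ω, (k ((ω.2 - s) / γ) * f ω.1) ^ 2 ∂P ≤ ∫ ω, M * k ((ω.2 - s) / γ) ∂P := by
          refine integral_mono_of_nonneg (ae_of_all _ fun _ => sq_nonneg _) (hki.const_mul M)
            (ae_of_all _ hpt)
      _ = M * ∫ ω, k ((ω.2 - s) / γ) ∂P := integral_const_mul _ _
      _ ≤ M * (Up * γ) :=
          mul_le_mul_of_nonneg_left (h.integral_scaled_le hk hdis hU hγ s) hM0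
      _ ≤ C * γ := by
          rw [← mul_assoc]
          refine mul_le_mul_of_nonneg_right ?_ hγ.le
          have : 0 ≤ 8 / Lp * (D * m₁ + B * σ) + 8 / Lp * (D * Up * σ + B * σ) := by positivity
          linarith
  · exact ((hTm.const_mul D).add_const _).const_mul _
  · intro s
    have := hT0 s
    positivity
  · intro s
    calc 8 / (Lp * γ) * (D * boundaryTail k 𝒮 γ s + B * (γ ^ 3 * σ))
        ≤ 8 / (Lp * γ) * (D * (γ ^ 2 * m₁) + B * (γ ^ 2 * σ)) := by
          have h1 : γ ^ 3 ≤ γ ^ 2 := pow_le_pow_of_le_one hγ.le hγ1 (by norm_num)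
          have h2 := hTle s
          gcongr
      _ = 8 / Lp * (D * m₁ + B * σ) * γ := by field_simp
      _ ≤ C * γ := by
          refine mul_le_mul_of_nonneg_right ?_ hγ.le
          have : 0 ≤ M * Up + 8 / Lp * (D * Up * σ + B * σ) := by positivity
          linarith
  · rw [integral_const_mul, integral_add (hTi.const_mul D) (integrable_const _),
      integral_const_mul]
    simp only [integral_const, probReal_univ, one_smul]
    calc _ ≤ 8 / (Lp * γ) * (D * (Up * (γ ^ 3 * σ)) + B * (γ ^ 3 * σ)) := by
          have := h.integral_boundaryTail_le hU hk hγ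
          gcongr
      _ = 8 / Lp * (D * Up * σ + B * σ) * γ ^ 2 := by field_simp
      _ ≤ C * γ ^ 2 := by
          refine mul_le_mul_of_nonneg_right ?_ (sq_nonneg _)
          have : 0 ≤ M * Up + 8 / Lp * (D * m₁ + B * σ) := by positivity
          linarith
  · filter_upwards [h.ae_map_snd_regular] with s hs
    have hge := h.integral_scaled_ge hk hdis hγ hd (HasDensities.mem_of_regular ha) hb' hγd
      (HasDensities.mem_of_regular hs)
    refine ⟨hge, fun f hf hf1 => ?_⟩
    refine (h.abs_bias_le hp hD hD' hk hγ hdis hκ' hs hf hf1).trans ?_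
    have hT := hT0 s
    calc 2 * D * boundaryTail k 𝒮 γ s + 2 * B * (γ ^ 3 * σ)
        = Lp / 4 * γ * (8 / (Lp * γ) * (D * boundaryTail k 𝒮 γ s + B * (γ ^ 3 * σ))) := by
          field_simp
          ring
      _ ≤ _ := mul_le_mul_of_nonneg_right hge (by positivity)

/-- The hypotheses on the densities yield a version of the conditional law of `X` given `S` for
which the kernel estimator has the expected bias and variance. -/
lemma exists_kernelEstimates {P : Measure (X × ℝ)} [IsProbabilityMeasure P] {𝒮 : Set ℝ}
    (h𝒮 : 𝒮.OrdConnected) (hPS : HasBoundedDensity P 𝒮) (hPXS : HasSmoothJointDensity P 𝒮)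
    {k : ℝ → ℝ} (hk : IsSmoothingFunction k) :
    ∃ κ : Kernel ℝ X, IsMarkovKernel κ ∧ P.map Prod.swap = (P.map Prod.snd) ⊗ₘ κ ∧
      ∃ C c₀ γ₀ : ℝ, 0 < C ∧ 0 < c₀ ∧ 0 < γ₀ ∧ ∀ γ, 0 < γ → γ ≤ γ₀ →
        ∃ b, KernelEstimates P κ k γ C c₀ b := by
  obtain ⟨pS, Lp, Up, hpS, hLp, hbd, hmarg⟩ := hPS
  obtain ⟨μ, p, hμ, hpm, hp0, hP, hdiff, B, hB⟩ := hPXS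
  have h : HasDensities P μ 𝒮 p pS Lp Up := ⟨h𝒮, hpm, hpS, hp0, hP, hmarg, hLp, hbd⟩
  have hnhds : ∀ s ∈ interior 𝒮, 𝒮 ∈ 𝓝 s := fun s hs => mem_interior_iff_mem_nhds.1 hs
  have hsm : IsSmoothFamily μ (interior 𝒮) (max B 0) p (fun x => derivWithin (p x) 𝒮)
      (fun x => derivWithin (derivWithin (p x) 𝒮) 𝒮) := by
    refine ⟨hpm, isOpen_interior, ?_, fun x s hs => ?_, fun x s hs => ?_, fun x => ?_,
      le_max_right _ _, fun s hs => ?_⟩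
    · exact h𝒮.convex.interior.ordConnected
    · exact ((hdiff x).1 s (interior_subset hs)).hasDerivWithinAt.hasDerivAt (hnhds s hs)
    · exact ((hdiff x).2.1 s (interior_subset hs)).hasDerivWithinAt.hasDerivAt (hnhds s hs)
    · obtain ⟨C, hC⟩ := (hdiff x).2.2
      exact ⟨C, fun s hs => hC s (interior_subset hs)⟩
    · exact (hB s (interior_subset hs)).trans (ENNReal.ofReal_le_ofReal (le_max_left _ _))
  exact h.exists_kernelEstimates hsm hk

end Bias

/-! ### The deviation events -/

section GoodSamples

variable {X : Type*} [MeasurableSpace X]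

/-- The unnormalised leave-one-out kernel estimator at the `i`-th sample point. -/
noncomputable def kernelSum (k : ℝ → ℝ) (γ : ℝ) {n : ℕ} (ω : Fin n → X × ℝ) (f : X → ℝ)
    (i : Fin n) : ℝ :=
  ∑ j ∈ Finset.univ.erase i, k (((ω j).2 - (ω i).2) / γ) * f (ω j).1

/-- The samples on which, with deviation parameter `t`, all empirical averages that enter the
estimated EIPM are close to their means, for test functions `f ∈ F` and discrepancies `Φ ∈ G`. -/
structure IsGoodSample (P : Measure (X × ℝ)) (κ : Kernel ℝ X) (k : ℝ → ℝ) (γ C C' c₀ : ℝ)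
    (b : ℝ → ℝ) (F : Finset (X → ℝ)) (G : Finset (ℝ → ℝ)) (t : ℝ) {m : ℕ}
    (ω : Fin (m + 1) → X × ℝ) : Prop where
  bias : ∀ i, c₀ * γ ≤ ∫ x, k ((x.2 - (ω i).2) / γ) ∂P ∧
    ∀ f : X → ℝ, Measurable f → (∀ x, |f x| ≤ 1) →
      |(∫ x, k ((x.2 - (ω i).2) / γ) * f x.1 ∂P)
          - (∫ x, f x ∂κ (ω i).2) * ∫ x, k ((x.2 - (ω i).2) / γ) ∂P|
        ≤ (∫ x, k ((x.2 - (ω i).2) / γ) ∂P) * b (ω i).2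
  numerator : ∀ f ∈ F, ∀ i, |kernelSum k γ ω f i - m * ∫ x, k ((x.2 - (ω i).2) / γ) * f x.1 ∂P|
    ≤ 2 * √(t * (m * (C' * γ)))
  mean : ∀ f ∈ F, |∑ j, f (ω j).1 - (m + 1 : ℕ) * ∫ x, f x.1 ∂P| ≤ 2 * √(t * ((m + 1 : ℕ) * 1))
  discrepancy : ∀ Φ ∈ G, |∑ j, Φ (ω j).2 - (m + 1 : ℕ) * ∫ x, Φ x.2 ∂P|
    ≤ 2 * √(t * ((m + 1 : ℕ) * 4))
  biasMean : |∑ j, b (ω j).2 - (m + 1 : ℕ) * ∫ x, b x.2 ∂P|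
    ≤ 2 * √(t * ((m + 1 : ℕ) * (C * γ) ^ 2))

lemma measure_exists_mem_finset_le {Ω α : Type*} [MeasurableSpace Ω] {μ : Measure Ω}
    {s : Finset α} {p : α → Ω → Prop} {q : ℝ}
    (h : ∀ a ∈ s, μ {ω | p a ω} ≤ ENNReal.ofReal q) :
    μ {ω | ∃ a ∈ s, p a ω} ≤ ENNReal.ofReal (s.card * q) := by
  have hset : {ω | ∃ a ∈ s, p a ω} = ⋃ a ∈ s, {ω | p a ω} := by
    ext ω
    simp
  rw [hset]
  refine (measure_biUnion_finset_le _ _).trans ((Finset.sum_le_card_nsmul _ _ _ h).trans ?_)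
  rw [nsmul_eq_mul, ENNReal.ofReal_mul (by positivity), ENNReal.ofReal_natCast]

variable {P : Measure (X × ℝ)} [IsProbabilityMeasure P] {κ : Kernel ℝ X} {k : ℝ → ℝ}
  {γ C C' c₀ M t : ℝ} {b : ℝ → ℝ} {F : Finset (X → ℝ)} {G : Finset (ℝ → ℝ)} {m : ℕ}

/-- The union bound over all deviation events. -/
lemma measure_not_isGoodSample_le (hk : IsSmoothingFunction k) (hM : ∀ s, k s ≤ M) (hγ : 0 < γ)
    (hC : 0 < C) (hCC : C ≤ C') (hb : KernelEstimates P κ k γ C c₀ b)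
    (hF : ∀ f ∈ F, Measurable f ∧ ∀ x, |f x| ≤ 1)
    (hG : ∀ Φ ∈ G, Measurable Φ ∧ ∀ s, |Φ s| ≤ 2) (hm : 0 < m) (ht : 0 ≤ t)
    (htm : M ^ 2 * t ≤ m * (C' * γ)) (htn : t ≤ (m + 1 : ℕ)) :
    (Measure.pi fun _ : Fin (m + 1) => P) {ω | ¬ IsGoodSample P κ k γ C C' c₀ b F G t ω}
      ≤ ENNReal.ofReal (2 * Real.exp (-t) * ((m + 2) * F.card + G.card + 1)) := by
  have hC' : 0 < C' := hC.trans_le hCC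
  set π := Measure.pi fun _ : Fin (m + 1) => P with hπ
  -- the exceptional null set of values of `S`
  have h0 : ∀ᵐ ω ∂π, ∀ i, c₀ * γ ≤ ∫ x, k ((x.2 - (ω i).2) / γ) ∂P ∧
      ∀ f : X → ℝ, Measurable f → (∀ x, |f x| ≤ 1) →
        |(∫ x, k ((x.2 - (ω i).2) / γ) * f x.1 ∂P)
            - (∫ x, f x ∂κ (ω i).2) * ∫ x, k ((x.2 - (ω i).2) / γ) ∂P|
          ≤ (∫ x, k ((x.2 - (ω i).2) / γ) ∂P) * b (ω i).2 := by
    refine ae_all_iff.2 fun i => ?_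
    exact (measurePreserving_eval (fun _ : Fin (m + 1) => P) i).quasiMeasurePreserving.ae
      (ae_of_ae_map measurable_snd.aemeasurable hb.ae_bias_le)
  have hF1 : π {ω | ∃ f ∈ F, ∃ i ∈ (Finset.univ : Finset (Fin (m + 1))),
      2 * √(t * (m * (C' * γ))) <
        |kernelSum k γ ω f i - m * ∫ x, k ((x.2 - (ω i).2) / γ) * f x.1 ∂P|}
      ≤ ENNReal.ofReal (F.card * ((m + 1) * (2 * Real.exp (-t)))) := by
    refine measure_exists_mem_finset_le fun f hf => ?_
    have hcard : ((m : ℝ) + 1) = (Finset.univ : Finset (Fin (m + 1))).card := by simp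
    rw [hcard]
    refine measure_exists_mem_finset_le fun i _ => ?_
    have hY : Measurable (Function.uncurry fun y x : X × ℝ => k ((x.2 - y.2) / γ) * f x.1) :=
      (hk.measurable.comp ((measurable_snd.comp measurable_snd).sub
        (measurable_snd.comp measurable_fst) |>.div_const γ)).mul
        ((hF f hf).1.comp (measurable_fst.comp measurable_snd))
    refine pi_abs_sum_erase_sub_gt_le (M := M) hY (fun y x => ?_) (fun y => ?_) (by positivity) ht
      hm htm i
    · rw [abs_mul, abs_of_nonneg (hk.nonneg _)]
      exact (mul_le_of_le_one_right (hk.nonneg _) ((hF f hf).2 _)).trans (hM _)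
    · exact (hb.integral_sq_le y.2 f (hF f hf).1 (hF f hf).2).trans
        (mul_le_mul_of_nonneg_right hCC hγ.le)
  have hsq : ∀ (Y : X × ℝ → ℝ) (D : ℝ), (∀ x, |Y x| ≤ D) → ∫ x, Y x ^ 2 ∂P ≤ D ^ 2 := by
    intro Y D hD
    refine (le_abs_self _).trans (abs_integral_le_of_abs_le fun x => ?_)
    rw [abs_pow]
    exact pow_le_pow_left₀ (abs_nonneg _) (hD x) 2
  have hF2 : π {ω | ∃ f ∈ F, 2 * √(t * ((m + 1 : ℕ) * 1)) <
      |∑ j, f (ω j).1 - (m + 1 : ℕ) * ∫ x, f x.1 ∂P|}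
      ≤ ENNReal.ofReal (F.card * (2 * Real.exp (-t))) := by
    refine measure_exists_mem_finset_le fun f hf => ?_
    refine pi_abs_sum_sub_gt_le (M := 1) (Y := fun x : X × ℝ => f x.1)
      ((hF f hf).1.comp measurable_fst) (fun x => (hF f hf).2 _) ?_ one_pos ht m.succ_pos
      (by linarith)
    simpa using hsq (fun x : X × ℝ => f x.1) 1 fun x => (hF f hf).2 _
  have hG1 : π {ω | ∃ Φ ∈ G, 2 * √(t * ((m + 1 : ℕ) * 4)) <
      |∑ j, Φ (ω j).2 - (m + 1 : ℕ) * ∫ x, Φ x.2 ∂P|}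
      ≤ ENNReal.ofReal (G.card * (2 * Real.exp (-t))) := by
    refine measure_exists_mem_finset_le fun Φ hΦ => ?_
    refine pi_abs_sum_sub_gt_le (M := 2) (Y := fun x : X × ℝ => Φ x.2)
      ((hG Φ hΦ).1.comp measurable_snd) (fun x => (hG Φ hΦ).2 _) ?_ four_pos ht m.succ_pos
      (by linarith)
    have := hsq (fun x : X × ℝ => Φ x.2) 2 fun x => (hG Φ hΦ).2 _
    norm_num at this ⊢
    exact this
  have hb1 : π {ω | 2 * √(t * ((m + 1 : ℕ) * (C * γ) ^ 2)) <
      |∑ j, b (ω j).2 - (m + 1 : ℕ) * ∫ x, b x.2 ∂P|} ≤ ENNReal.ofReal (2 * Real.exp (-t)) := by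
    have hbb : ∀ x : X × ℝ, |b x.2| ≤ C * γ := fun x => by
      rw [abs_of_nonneg (hb.nonneg _)]
      exact hb.le _
    refine pi_abs_sum_sub_gt_le (M := C * γ) (Y := fun x : X × ℝ => b x.2)
      (hb.measurable.comp measurable_snd) hbb (hsq _ _ hbb) (by positivity) ht m.succ_pos ?_
    rw [mul_comm]
    exact mul_le_mul_of_nonneg_right htn (sq_nonneg _)
  have hcover : {ω | ¬ IsGoodSample P κ k γ C C' c₀ b F G t ω} ⊆
      {ω | ¬ ∀ i, c₀ * γ ≤ ∫ x, k ((x.2 - (ω i).2) / γ) ∂P ∧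
        ∀ f : X → ℝ, Measurable f → (∀ x, |f x| ≤ 1) →
          |(∫ x, k ((x.2 - (ω i).2) / γ) * f x.1 ∂P)
              - (∫ x, f x ∂κ (ω i).2) * ∫ x, k ((x.2 - (ω i).2) / γ) ∂P|
            ≤ (∫ x, k ((x.2 - (ω i).2) / γ) ∂P) * b (ω i).2} ∪
      ({ω | ∃ f ∈ F, ∃ i ∈ (Finset.univ : Finset (Fin (m + 1))),
        2 * √(t * (m * (C' * γ))) <
          |kernelSum k γ ω f i - m * ∫ x, k ((x.2 - (ω i).2) / γ) * f x.1 ∂P|} ∪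
      ({ω | ∃ f ∈ F, 2 * √(t * ((m + 1 : ℕ) * 1)) <
        |∑ j, f (ω j).1 - (m + 1 : ℕ) * ∫ x, f x.1 ∂P|} ∪
      ({ω | ∃ Φ ∈ G, 2 * √(t * ((m + 1 : ℕ) * 4)) <
        |∑ j, Φ (ω j).2 - (m + 1 : ℕ) * ∫ x, Φ x.2 ∂P|} ∪
      {ω | 2 * √(t * ((m + 1 : ℕ) * (C * γ) ^ 2)) <
        |∑ j, b (ω j).2 - (m + 1 : ℕ) * ∫ x, b x.2 ∂P|}))) := by
    intro ω hω
    by_contra hcon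
    simp only [Set.mem_union, not_or] at hcon
    obtain ⟨c1, c2, c3, c4, c5⟩ := hcon
    refine hω ⟨not_not.1 c1, fun f hf i => ?_, fun f hf => ?_, fun Φ hΦ => ?_, not_lt.1 c5⟩
    · exact not_lt.1 fun hlt => c2 ⟨f, hf, i, Finset.mem_univ i, hlt⟩
    · exact not_lt.1 fun hlt => c3 ⟨f, hf, hlt⟩
    · exact not_lt.1 fun hlt => c4 ⟨Φ, hΦ, hlt⟩
  refine (measure_mono hcover).trans ?_
  refine (measure_union_le _ _).trans ?_
  rw [ae_iff.1 h0, zero_add]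
  refine (measure_union_le _ _).trans ((add_le_add hF1 ((measure_union_le _ _).trans
    (add_le_add hF2 ((measure_union_le _ _).trans (add_le_add hG1 hb1))))).trans (le_of_eq ?_))
  rw [← ENNReal.ofReal_add (by positivity) (by positivity),
    ← ENNReal.ofReal_add (by positivity) (by positivity),
    ← ENNReal.ofReal_add (by positivity) (by positivity)]
  congr 1
  ring

end GoodSamples

/-! ### Comparing the estimated EIPM with the EIPM on a good sample -/

section Comparison

variable {X Z : Type*}

section KernelSum

variable {k : ℝ → ℝ} {γ : ℝ} {n : ℕ} {ω : Fin n → X × ℝ} {f f' : X → ℝ} {i : Fin n}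

lemma kernelSum_one_nonneg (hk : IsSmoothingFunction k) : 0 ≤ kernelSum k γ ω (fun _ => 1) i :=
  Finset.sum_nonneg fun _ _ => mul_nonneg (hk.nonneg _) zero_le_one

lemma abs_kernelSum_sub_le (hk : IsSmoothingFunction k) {r : ℝ} (h : ∀ x, |f x - f' x| ≤ r) :
    |kernelSum k γ ω f i - kernelSum k γ ω f' i| ≤ r * kernelSum k γ ω (fun _ => 1) i := by
  simp only [kernelSum]
  rw [← Finset.sum_sub_distrib, Finset.mul_sum]
  refine (Finset.abs_sum_le_sum_abs _ _).trans (Finset.sum_le_sum fun j _ => ?_)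
  rw [← mul_sub, abs_mul, abs_of_nonneg (hk.nonneg _), mul_one, mul_comm]
  exact mul_le_mul_of_nonneg_right (h _) (hk.nonneg _)

lemma abs_kernelSum_le (hk : IsSmoothingFunction k) (h : ∀ x, |f x| ≤ 1) :
    |kernelSum k γ ω f i| ≤ kernelSum k γ ω (fun _ => 1) i := by
  have := abs_kernelSum_sub_le (γ := γ) (ω := ω) (i := i) (f := f) (f' := fun _ => 0) (r := 1) hk
    (by simpa using h)
  simpa [kernelSum] using this

end KernelSum

lemma abs_div_le_of_abs_le {a d r : ℝ} (hd : 0 ≤ d) (hr : 0 ≤ r) (h : |a| ≤ r * d) :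
    |a / d| ≤ r := by
  rw [abs_div, abs_of_nonneg hd]
  exact div_le_of_le_mul₀ hd hr h

/-- The error of a ratio estimator. The numerator is dominated by the denominator, so the identity
`N / D - e = (N - m ν) / (m μ) + (N / D) (m μ - D) / (m μ) + (ν - e μ) / μ`, which also holds when
`N = D = 0`, needs no lower bound on the random denominator `D`. -/
lemma abs_ratio_sub_le {N D ν μ e b m τ c : ℝ} (hm : 0 < m) (hc : 0 < c) (hD : 0 ≤ D)
    (hND : |N| ≤ D) (hN : |N - m * ν| ≤ τ) (hDμ : |D - m * μ| ≤ τ) (hcμ : c ≤ μ)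
    (hb : |ν - e * μ| ≤ μ * b) : |N / D - e| ≤ 2 * τ / (m * c) + b := by
  have hμ : 0 < μ := hc.trans_le hcμ
  have hτ : 0 ≤ τ := (abs_nonneg _).trans hN
  have hq : |N / D| ≤ 1 := abs_div_le_of_abs_le hD zero_le_one (by simpa using hND)
  have hqD : N / D * D = N := by
    rcases hD.eq_or_lt with h0 | h0
    · rw [← h0] at hND ⊢
      rw [mul_zero]
      exact (abs_nonpos_iff.1 hND).symm
    · field_simp
  have heq : N / D - e = ((N - m * ν) + N / D * (m * μ - D)) / (m * μ) + (ν - e * μ) / μ := by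
    rw [mul_sub, hqD]
    field_simp
    ring
  rw [heq]
  refine (abs_add_le _ _).trans (add_le_add ?_ ?_)
  · rw [abs_div, abs_of_pos (by positivity : 0 < m * μ)]
    refine div_le_div₀ (by positivity) ?_ (by positivity) (mul_le_mul_of_nonneg_left hcμ hm.le)
    refine (abs_add_le _ _).trans ?_
    rw [abs_mul, abs_sub_comm (m * μ)]
    have := mul_le_mul hq hDμ (abs_nonneg _) zero_le_one
    linarith
  · rw [abs_div, abs_of_pos hμ]
    exact div_le_of_le_mul₀ hμ.le (nonneg_of_mul_nonneg_right ((abs_nonneg _).trans hb) hμ)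
      (by linarith)

section Formula

variable [MeasurableSpace Z] [MeasurableSingletonClass Z] {k : ℝ → ℝ} {γ : ℝ} {V : Set (Z → ℝ)}
  {h : X → Z} {m : ℕ} {ω : Fin (m + 1) → X × ℝ}

lemma integral_sum_smul_dirac {ι : Type*} (s : Finset ι) (w : ι → ℝ) (hw : ∀ j ∈ s, 0 ≤ w j)
    (z : ι → Z) (v : Z → ℝ) :
    ∫ y, v y ∂(∑ j ∈ s, ENNReal.ofReal (w j) • Measure.dirac (z j)) = ∑ j ∈ s, w j * v (z j) := by
  rw [integral_finsetSum_measure]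
  · refine Finset.sum_congr rfl fun j hj => ?_
    rw [integral_smul_measure, integral_dirac, ENNReal.toReal_ofReal (hw j hj), smul_eq_mul]
  · intro j _
    exact (integrable_dirac (by simp)).smul_measure ENNReal.ofReal_ne_top

lemma estEIPM_eq (hk : IsSmoothingFunction k) :
    estEIPM k γ V h ω = (1 / ((m + 1 : ℕ) : ℝ)) * ∑ i, ⨆ v : V,
      |kernelSum k γ ω (fun x => (v : Z → ℝ) (h x)) i / kernelSum k γ ω (fun _ => 1) i
        - (∑ j ∈ Finset.univ.erase i, (v : Z → ℝ) (h (ω j).1)) / m| := by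
  unfold estEIPM IPM condEmpirical margEmpirical
  congr 1
  refine Finset.sum_congr rfl fun i _ => ?_
  congr 1
  funext v
  rw [integral_sum_smul_dirac _ _ (fun j _ => ?_), integral_sum_smul_dirac _ _ (fun j _ => ?_)]
  · congr 2
    · simp only [weight, scaledKernel, kernelSum, mul_one, Finset.sum_div]
      exact Finset.sum_congr rfl fun j _ => by ring
    · rw [Finset.sum_div]
      refine Finset.sum_congr rfl fun j _ => ?_
      push_cast
      rw [add_sub_cancel_right]
      ring
  · push_cast
    rw [add_sub_cancel_right]
    positivity
  · exact div_nonneg (hk.nonneg _) (Finset.sum_nonneg fun _ _ => hk.nonneg _)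

lemma abs_erase_mean_le {f : X → ℝ} (hf : ∀ x, |f x| ≤ 1) (i : Fin (m + 1)) :
    |(∑ j ∈ Finset.univ.erase i, f (ω j).1) / m| ≤ 1 := by
  refine abs_div_le_of_abs_le (by positivity) zero_le_one ?_
  calc |∑ j ∈ Finset.univ.erase i, f (ω j).1| ≤ ∑ _j ∈ Finset.univ.erase i, (1 : ℝ) :=
        (Finset.abs_sum_le_sum_abs _ _).trans (Finset.sum_le_sum fun j _ => hf _)
    _ = 1 * m := by simp

lemma abs_estimate_le_two (hk : IsSmoothingFunction k) {f : X → ℝ} (hf : ∀ x, |f x| ≤ 1)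
    (i : Fin (m + 1)) :
    |kernelSum k γ ω f i / kernelSum k γ ω (fun _ => 1) i
        - (∑ j ∈ Finset.univ.erase i, f (ω j).1) / m| ≤ 2 := by
  refine (abs_sub _ _).trans ?_
  have h1 : |kernelSum k γ ω f i / kernelSum k γ ω (fun _ => 1) i| ≤ 1 :=
    abs_div_le_of_abs_le (kernelSum_one_nonneg hk) zero_le_one
      (by simpa using abs_kernelSum_le hk hf)
  have h2 := abs_erase_mean_le (ω := ω) hf i
  linarith

lemma estEIPM_nonneg (hk : IsSmoothingFunction k) : 0 ≤ estEIPM k γ V h ω := by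
  rw [estEIPM_eq hk]
  exact mul_nonneg (by positivity) (Finset.sum_nonneg fun i _ =>
    Real.iSup_nonneg fun _ => abs_nonneg _)

lemma estEIPM_le_two (hk : IsSmoothingFunction k) (hV : ∀ v ∈ V, ∀ z, |v z| ≤ 1) :
    estEIPM k γ V h ω ≤ 2 := by
  rw [estEIPM_eq hk, one_div, inv_mul_le_iff₀ (by positivity)]
  refine (Finset.sum_le_card_nsmul _ _ 2 fun i _ => ?_).trans (le_of_eq (by simp))
  exact Real.iSup_le (fun v => abs_estimate_le_two (f := fun x => (v : Z → ℝ) (h x)) hk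
    (fun x => hV v v.2 _) i) zero_le_two

end Formula

variable [MeasurableSpace X] {P : Measure (X × ℝ)} [IsProbabilityMeasure P] {κ : Kernel ℝ X}
  [IsMarkovKernel κ] {k : ℝ → ℝ} {γ C C' c₀ t : ℝ} {b : ℝ → ℝ} {F : Finset (X → ℝ)}
  {G : Finset (ℝ → ℝ)} {m : ℕ} {ω : Fin (m + 1) → X × ℝ}

/-- For one test function and one sample point, the empirical difference of conditional and marginal
means is close to the true one. -/
lemma IsGoodSample.abs_estimate_sub_le (hω : IsGoodSample P κ k γ C C' c₀ b F G t ω)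
    (hk : IsSmoothingFunction k) (hγ : 0 < γ) (hc₀ : 0 < c₀) (hm : 0 < m)
    (h1 : (fun _ => 1) ∈ F) {f f' : X → ℝ} {r : ℝ} (hf : Measurable f) (hf1 : ∀ x, |f x| ≤ 1)
    (hf' : Measurable f') (hf1' : ∀ x, |f' x| ≤ 1) (hfF : f' ∈ F) (hr : ∀ x, |f x - f' x| ≤ r)
    (hr0 : 0 ≤ r) (i : Fin (m + 1)) :
    |(kernelSum k γ ω f i / kernelSum k γ ω (fun _ => 1) i
        - (∑ j ∈ Finset.univ.erase i, f (ω j).1) / m)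
        - ((∫ x, f x ∂κ (ω i).2) - ∫ x, f x ∂(P.map Prod.fst))|
      ≤ 4 * r + 2 * (2 * √(t * (m * (C' * γ)))) / (m * (c₀ * γ))
        + (2 * √(t * ((m + 1 : ℕ) * 1)) + 2) / m + b (ω i).2 := by
  have hm' : (0 : ℝ) < m := by exact_mod_cast hm
  have hprob : IsProbabilityMeasure (P.map Prod.fst) :=
    Measure.isProbabilityMeasure_map measurable_fst.aemeasurable
  have hD := kernelSum_one_nonneg (γ := γ) (ω := ω) (i := i) hk
  have a1 : |kernelSum k γ ω f i / kernelSum k γ ω (fun _ => 1) i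
      - kernelSum k γ ω f' i / kernelSum k γ ω (fun _ => 1) i| ≤ r := by
    rw [← sub_div]
    exact abs_div_le_of_abs_le hD hr0 (abs_kernelSum_sub_le hk hr)
  have a2 : |kernelSum k γ ω f' i / kernelSum k γ ω (fun _ => 1) i - ∫ x, f' x ∂κ (ω i).2|
      ≤ 2 * (2 * √(t * (m * (C' * γ)))) / (m * (c₀ * γ)) + b (ω i).2 := by
    have e1 := hω.numerator _ h1 i
    simp only [mul_one] at e1
    exact abs_ratio_sub_le hm' (by positivity) hD (abs_kernelSum_le hk hf1') (hω.numerator f' hfF i)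
      (by simpa using e1) (hω.bias i).1 ((hω.bias i).2 f' hf' hf1')
  have a3 := abs_integral_sub_integral_le (μ := κ (ω i).2) hf hf' hf1 hf1' hr
  have a4 := abs_integral_sub_integral_le (μ := P.map Prod.fst) hf hf' hf1 hf1' hr
  have a5 : |(∑ j ∈ Finset.univ.erase i, f (ω j).1) / m
      - (∑ j ∈ Finset.univ.erase i, f' (ω j).1) / m| ≤ r := by
    rw [← sub_div, ← Finset.sum_sub_distrib]
    refine abs_div_le_of_abs_le hm'.le hr0 ?_
    calc |∑ j ∈ Finset.univ.erase i, (f (ω j).1 - f' (ω j).1)|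
        ≤ ∑ _j ∈ Finset.univ.erase i, r :=
          (Finset.abs_sum_le_sum_abs _ _).trans (Finset.sum_le_sum fun j _ => hr _)
      _ = r * m := by simp [mul_comm]
  have a6 : |(∑ j ∈ Finset.univ.erase i, f' (ω j).1) / m - ∫ x, f' x ∂(P.map Prod.fst)|
      ≤ (2 * √(t * ((m + 1 : ℕ) * 1)) + 2) / m := by
    have e1 := hω.mean f' hfF
    have e2 : ∫ x, f' x.1 ∂P = ∫ x, f' x ∂(P.map Prod.fst) :=
      (integral_map measurable_fst.aemeasurable hf'.aestronglyMeasurable).symm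
    rw [e2] at e1
    set J := ∫ x, f' x ∂(P.map Prod.fst) with hJ
    have hJ1 : |J| ≤ 1 := abs_integral_le_of_abs_le hf1'
    have e3 : (∑ j ∈ Finset.univ.erase i, f' (ω j).1) / m - J
        = ((∑ j, f' (ω j).1 - (m + 1 : ℕ) * J) + (J - f' (ω i).1)) / m := by
      rw [Finset.sum_erase_eq_sub (Finset.mem_univ i)]
      field_simp
      push_cast
      ring
    rw [e3, abs_div, abs_of_pos hm']
    refine div_le_div_of_nonneg_right ((abs_add_le _ _).trans (add_le_add e1 ?_)) hm'.le
    exact (abs_sub _ _).trans (by linarith [hf1' (ω i).1])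
  rw [abs_le] at *
  constructor <;> linarith

variable [MeasurableSpace Z] [MeasurableSingletonClass Z] {V : Set (Z → ℝ)} {h h' : X → Z}

/-- On a good sample the estimated EIPM is close to the EIPM, for every encoder that is uniformly
close to one of the centres. -/
lemma IsGoodSample.abs_estEIPM_sub_le (hω : IsGoodSample P κ k γ C C' c₀ b F G t ω)
    (hk : IsSmoothingFunction k) (hb : KernelEstimates P κ k γ C c₀ b) (hγ : 0 < γ) (hc₀ : 0 < c₀)
    (hm : 0 < m) (h1 : (fun _ => 1) ∈ F) {r : ℝ} (hr0 : 0 ≤ r)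
    (hV : ∀ v ∈ V, ∀ z, |v z| ≤ 1) (hVm : ∀ v ∈ V, Measurable v)
    (hcov : ∀ r : ℝ≥0, 0 < r → supCoveringNumber r V ≠ ⊤)
    (hh : Measurable h) (hh' : Measurable h')
    (hhh : ∀ v ∈ V, ∀ x, |v (h x) - v (h' x)| ≤ r)
    (hF : ∀ v ∈ V, ∃ v' ∈ V, (fun x => v' (h' x)) ∈ F ∧ ∀ x, |v (h x) - v' (h' x)| ≤ r)
    (hG : condDiscrepancy κ (P.map Prod.fst) V h' ∈ G) :
    |estEIPM k γ V h ω - ∫ s, condDiscrepancy κ (P.map Prod.fst) V h s ∂(P.map Prod.snd)|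
      ≤ 8 * r + 2 * (2 * √(t * (m * (C' * γ)))) / (m * (c₀ * γ))
        + (2 * √(t * ((m + 1 : ℕ) * 1)) + 2) / m + 2 * √(t * ((m + 1 : ℕ) * 4)) / (m + 1 : ℕ)
        + C * γ ^ 2 + 2 * √(t * ((m + 1 : ℕ) * (C * γ) ^ 2)) / (m + 1 : ℕ) := by
  have hprob : IsProbabilityMeasure (P.map Prod.fst) :=
    Measure.isProbabilityMeasure_map measurable_fst.aemeasurable
  have hprob' : IsProbabilityMeasure (P.map Prod.snd) :=
    Measure.isProbabilityMeasure_map measurable_snd.aemeasurable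
  set Q := P.map Prod.fst with hQ
  set E := 2 * (2 * √(t * (m * (C' * γ)))) / (m * (c₀ * γ))
    + (2 * √(t * ((m + 1 : ℕ) * 1)) + 2) / m with hE
  have hE0 : 0 ≤ E := by positivity
  set n : ℝ := ((m + 1 : ℕ) : ℝ) with hn
  have hn0 : 0 < n := by simp only [hn]; positivity
  have hcompm : ∀ {g : X → Z}, Measurable g → ∀ v ∈ V, Measurable fun x => v (g x) :=
    fun hg v hv => (hVm v hv).comp hg
  have hΦm := measurable_condDiscrepancy (κ := κ) (Q := Q) hV (hcompm hh) hcov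
  have hΦm' := measurable_condDiscrepancy (κ := κ) (Q := Q) hV (hcompm hh') hcov
  have hclose := abs_condDiscrepancy_sub_le (κ := κ) (Q := Q) hr0 hV (hcompm hh) (hcompm hh') hhh
  -- the empirical IPM at each sample point
  have hpt : ∀ i : Fin (m + 1), |(⨆ v : V,
      |kernelSum k γ ω (fun x => (v : Z → ℝ) (h x)) i / kernelSum k γ ω (fun _ => 1) i
        - (∑ j ∈ Finset.univ.erase i, (v : Z → ℝ) (h (ω j).1)) / m|)
      - condDiscrepancy κ Q V h (ω i).2| ≤ 4 * r + E + b (ω i).2 := by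
    intro i
    refine abs_iSup_sub_iSup_le ?_ ?_ (bddAbove_condDiscrepancy hV _) fun v => ?_
    · have := hb.nonneg (ω i).2
      positivity
    · refine ⟨2, ?_⟩
      rintro _ ⟨v, rfl⟩
      exact abs_estimate_le_two (f := fun x => (v : Z → ℝ) (h x)) hk (fun x => hV v v.2 _) i
    · obtain ⟨v', hv', hvF, hvr⟩ := hF v v.2
      refine (abs_abs_sub_abs_le_abs_sub _ _).trans ?_
      have := hω.abs_estimate_sub_le hk hγ hc₀ hm h1 (hcompm hh v v.2) (fun x => hV v v.2 _)
        (hcompm hh' v' hv') (fun x => hV v' hv' _) hvF hvr hr0 i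
      refine this.trans (le_of_eq ?_)
      simp only [hE]
      ring
  have hsum1 : |estEIPM k γ V h ω - (∑ i, condDiscrepancy κ Q V h (ω i).2) / n|
      ≤ 4 * r + E + (∑ i, b (ω i).2) / n := by
    rw [estEIPM_eq hk, one_div, inv_mul_eq_div, ← sub_div, ← Finset.sum_sub_distrib, abs_div,
      abs_of_pos hn0, div_le_iff₀ hn0, add_mul, div_mul_cancel₀ _ hn0.ne']
    refine (Finset.abs_sum_le_sum_abs _ _).trans ((Finset.sum_le_sum fun i _ => hpt i).trans ?_)
    rw [Finset.sum_add_distrib, Finset.sum_const, Finset.card_univ, Fintype.card_fin, nsmul_eq_mul,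
      mul_comm (4 * r + E)]
  have hmap : ∀ g : ℝ → ℝ, Measurable g → ∫ x, g x.2 ∂P = ∫ s, g s ∂(P.map Prod.snd) :=
    fun g hg => (integral_map measurable_snd.aemeasurable hg.aestronglyMeasurable).symm
  have hbias : (∑ i, b (ω i).2) / n ≤ C * γ ^ 2 + 2 * √(t * (n * (C * γ) ^ 2)) / n := by
    have e1 := (abs_le.1 hω.biasMean).2
    rw [hmap b hb.measurable] at e1
    have e2 := mul_le_mul_of_nonneg_left hb.integral_le hn0.le
    rw [div_le_iff₀ hn0, add_mul, div_mul_cancel₀ _ hn0.ne']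
    linarith
  have hdev : |(∑ i, condDiscrepancy κ Q V h' (ω i).2) / n
      - ∫ s, condDiscrepancy κ Q V h' s ∂(P.map Prod.snd)| ≤ 2 * √(t * (n * 4)) / n := by
    have e1 := hω.discrepancy _ hG
    rw [hmap _ hΦm'] at e1
    rw [div_sub' hn0.ne', abs_div, abs_of_pos hn0]
    exact div_le_div_of_nonneg_right e1 hn0.le
  have hsw : |(∑ i, condDiscrepancy κ Q V h (ω i).2) / n
      - (∑ i, condDiscrepancy κ Q V h' (ω i).2) / n| ≤ 2 * r := by
    rw [← sub_div, ← Finset.sum_sub_distrib, abs_div, abs_of_pos hn0, div_le_iff₀ hn0]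
    calc _ ≤ ∑ _i : Fin (m + 1), 2 * r :=
          (Finset.abs_sum_le_sum_abs _ _).trans (Finset.sum_le_sum fun i _ => hclose _)
      _ = 2 * r * n := by simp [hn, mul_comm]
  have hsw' := abs_integral_sub_integral_le (μ := P.map Prod.snd) hΦm hΦm'
    (abs_condDiscrepancy_le_two hV) (abs_condDiscrepancy_le_two hV) hclose
  rw [abs_le] at *
  constructor <;> linarith

end Comparison

/-! ### The rate -/

section Rate

/-- All error terms are bounded by the deviation scale `√(t / (n γ))`, up to the squared
bandwidth. -/
lemma error_le {m : ℕ} (hm : 0 < m) {γ t C C' c₀ : ℝ} (hγ : 0 < γ) (hγ1 : γ ≤ 1) (ht : 1 ≤ t)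
    (hC : 0 < C) (hC' : 0 < C') (hc₀ : 0 < c₀) :
    8 * (2 * √(γ / (m + 1 : ℕ))) + 2 * (2 * √(t * (m * (C' * γ)))) / (m * (c₀ * γ))
        + (2 * √(t * ((m + 1 : ℕ) * 1)) + 2) / m + 2 * √(t * ((m + 1 : ℕ) * 4)) / (m + 1 : ℕ)
        + C * γ ^ 2 + 2 * √(t * ((m + 1 : ℕ) * (C * γ) ^ 2)) / (m + 1 : ℕ)
      ≤ (28 + 8 * √C' / c₀ + 2 * C) * √(t / ((m + 1 : ℕ) * γ)) + C * γ ^ 2 := by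
  have hm0 : (1 : ℝ) ≤ m := by exact_mod_cast hm
  set n : ℝ := ((m + 1 : ℕ) : ℝ) with hn
  have hnm : n = m + 1 := by simp [hn]
  have hn1 : 1 ≤ n := by linarith
  set R := √(t / (n * γ)) with hR
  have hR0 : 0 ≤ R := Real.sqrt_nonneg _
  have hR2 : R ^ 2 = t / (n * γ) := Real.sq_sqrt (by positivity)
  have hRn : R ^ 2 * n = t / γ := by rw [hR2]; field_simp
  have htγ : t ≤ t / γ := by
    rw [le_div_iff₀ hγ]
    nlinarith
  have htγ1 : 1 ≤ t / γ := ht.trans htγ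
  have hsqrt : ∀ x y : ℝ, 0 ≤ y → x ≤ y ^ 2 → √x ≤ y := fun x y hy h => Real.sqrt_le_iff.2 ⟨hy, h⟩
  have b1 : √(γ / n) ≤ R := by
    refine hsqrt _ _ hR0 ?_
    rw [hR2, div_le_div_iff₀ (by positivity) (by positivity)]
    nlinarith [mul_le_mul hγ1 hγ1 hγ.le zero_le_one]
  have b2 : 2 * (2 * √(t * (m * (C' * γ)))) / (m * (c₀ * γ)) ≤ 8 * √C' / c₀ * R := by
    have : √(t * (m * (C' * γ))) ≤ 2 * √C' * R * (m * γ) := by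
      refine hsqrt _ _ (by positivity) ?_
      rw [mul_pow, mul_pow, mul_pow, Real.sq_sqrt hC'.le, hR2]
      rw [show 2 ^ 2 * C' * (t / (n * γ)) * (m * γ) ^ 2 = 4 * C' * t * m ^ 2 * γ / n by
        field_simp; ring, le_div_iff₀ (by positivity)]
      have : t * C' * γ * m * n ≤ t * C' * γ * m * (4 * m) := by
        refine mul_le_mul_of_nonneg_left ?_ (by positivity)
        linarith
      nlinarith
    rw [div_le_iff₀ (by positivity)]
    calc 2 * (2 * √(t * (m * (C' * γ)))) ≤ 2 * (2 * (2 * √C' * R * (m * γ))) := by linarith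
      _ = _ := by field_simp; ring
  have b3 : (2 * √(t * (n * 1)) + 2) / m ≤ 8 * R := by
    have h1 : √(t * (n * 1)) ≤ n * R := by
      refine hsqrt _ _ (by positivity) ?_
      rw [mul_pow, sq n, mul_assoc, mul_comm n (R ^ 2), hRn]
      nlinarith
    have h2 : 1 ≤ n * R := by
      refine (one_le_sq_iff₀ (by positivity)).1 ?_
      rw [mul_pow, sq n, mul_assoc, mul_comm n (R ^ 2), hRn]
      nlinarith
    rw [div_le_iff₀ (by linarith)]
    have h3 : n * R ≤ 2 * m * R := mul_le_mul_of_nonneg_right (by linarith) hR0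
    nlinarith
  have b4 : 2 * √(t * (n * 4)) / n ≤ 4 * R := by
    have h1 : √(t * (n * 4)) ≤ 2 * n * R := by
      refine hsqrt _ _ (by positivity) ?_
      rw [show (2 * n * R) ^ 2 = 4 * n * (R ^ 2 * n) by ring, hRn]
      nlinarith
    rw [div_le_iff₀ (by linarith)]
    nlinarith
  have b5 : 2 * √(t * (n * (C * γ) ^ 2)) / n ≤ 2 * C * R := by
    have h1 : √(t * (n * (C * γ) ^ 2)) ≤ C * n * R := by
      refine hsqrt _ _ (by positivity) ?_
      rw [show (C * n * R) ^ 2 = C ^ 2 * n * (R ^ 2 * n) by ring, hRn]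
      have hg : t * γ ^ 2 ≤ t / γ := (mul_le_of_le_one_right (by linarith)
        (pow_le_one₀ hγ.le hγ1)).trans htγ
      nlinarith [mul_le_mul_of_nonneg_left hg (by positivity : 0 ≤ C ^ 2 * n)]
    rw [div_le_iff₀ (by linarith)]
    nlinarith
  nlinarith

/-- The deviation scale is bounded by the rate. -/
lemma sqrt_div_le {n : ℕ} {γ l l' : ℝ} (hγ : 0 < γ) (hn : 3 ≤ n) (hl : 0 ≤ l) (hl' : 0 ≤ l') :
    √((4 * Real.log n + l + l') / (n * γ)) ≤ 2 * (Real.log n / √(n * γ) * √(1 + l + l')) := by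
  have hn3 : (3 : ℝ) ≤ n := by exact_mod_cast hn
  have hlog : 1 ≤ Real.log n := by
    rw [Real.le_log_iff_exp_le (by linarith)]
    linarith [Real.exp_one_lt_d9]
  refine Real.sqrt_le_iff.2 ⟨by positivity, ?_⟩
  rw [mul_pow, mul_pow, div_pow, Real.sq_sqrt (by positivity), Real.sq_sqrt (by positivity),
    div_mul_eq_mul_div, ← mul_div_assoc]
  refine div_le_div_of_nonneg_right ?_ (by positivity)
  have h2 : Real.log n ≤ Real.log n ^ 2 := by nlinarith
  have h3 : 1 ≤ Real.log n ^ 2 := hlog.trans h2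
  nlinarith [mul_le_mul_of_nonneg_right h3 hl, mul_le_mul_of_nonneg_right h3 hl']

lemma exp_neg_log_mul_le_one (N : ℕ) : Real.exp (-Real.log N) * N ≤ 1 := by
  rcases N.eq_zero_or_pos with rfl | hN
  · simp
  · rw [Real.exp_neg, Real.exp_log (by positivity), inv_mul_cancel₀ (by positivity)]

lemma exp_neg_log_le_one (N : ℕ) : Real.exp (-Real.log N) ≤ 1 :=
  Real.exp_le_one_iff.2 (neg_nonpos.2 (Real.log_natCast_nonneg N))

/-- The total failure probability, for the deviation parameter
`t = 4 log n + log N + log N'`. -/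
lemma failure_probability_le {m N N' a a' : ℕ} (hm : 0 < m) (ha : a ≤ N * N' + 1) (ha' : a' ≤ N') :
    2 * Real.exp (-(4 * Real.log (m + 1 : ℕ) + Real.log N + Real.log N')) * ((m + 2) * a + a' + 1)
      ≤ 4 / (m + 1 : ℕ) := by
  have hm0 : (1 : ℝ) ≤ m := by exact_mod_cast hm
  have ha0 : (a : ℝ) ≤ N * N' + 1 := by exact_mod_cast ha
  have ha1 : (a' : ℝ) ≤ N' := by exact_mod_cast ha'
  set n : ℝ := ((m + 1 : ℕ) : ℝ) with hn
  have hnm : n = m + 1 := by simp [hn]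
  have hn0 : 0 < n := by linarith
  have hexp : Real.exp (-(4 * Real.log n + Real.log N + Real.log N'))
      = (n ^ 4)⁻¹ * (Real.exp (-Real.log N) * Real.exp (-Real.log N')) := by
    rw [← Real.exp_add, ← Real.exp_log hn0, ← Real.exp_nat_mul, ← Real.exp_neg, ← Real.exp_add,
      Real.exp_log hn0]
    congr 1
    push_cast
    ring
  set e := Real.exp (-Real.log N)
  set e' := Real.exp (-Real.log N')
  have he : 0 ≤ e := (Real.exp_pos _).le
  have he' : 0 ≤ e' := (Real.exp_pos _).le
  have h1 : e * N ≤ 1 := exp_neg_log_mul_le_one N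
  have h2 : e' * N' ≤ 1 := exp_neg_log_mul_le_one N'
  have h3 : e ≤ 1 := exp_neg_log_le_one N
  have h4 : e' ≤ 1 := exp_neg_log_le_one N'
  have h5 : e * e' ≤ 1 := mul_le_one₀ h3 he' h4
  have h6 : e * e' * (N * N') ≤ 1 := by
    calc e * e' * (N * N') = (e * N) * (e' * N') := by ring
      _ ≤ 1 := mul_le_one₀ h1 (by positivity) h2
  have h7 : e * e' * a ≤ 2 := by
    calc e * e' * a ≤ e * e' * (N * N' + 1) := mul_le_mul_of_nonneg_left ha0 (by positivity)
      _ ≤ 2 := by linarith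
  have h8 : e * e' * a' ≤ 1 := by
    calc e * e' * a' ≤ e * e' * N' := mul_le_mul_of_nonneg_left ha1 (by positivity)
      _ = e * (e' * N') := by ring
      _ ≤ 1 := mul_le_one₀ h3 (by positivity) h2
  rw [hexp, show 2 * ((n ^ 4)⁻¹ * (e * e')) * ((m + 2) * a + a' + 1)
    = 2 * ((m + 2) * (e * e' * a) + e * e' * a' + e * e') / n ^ 4 by field_simp,
    div_le_div_iff₀ (by positivity) hn0]
  have h9 : (m + 2) * (e * e' * a) ≤ (m + 2) * 2 := mul_le_mul_of_nonneg_left h7 (by positivity)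
  have h10 : 2 * ((m + 2) * (e * e' * a) + e * e' * a' + e * e') ≤ 4 * n ^ 3 := by
    have hn2 : 2 ≤ n := by linarith
    have : 8 * n ≤ 4 * n ^ 3 := by nlinarith [mul_le_mul hn2 hn2 zero_le_two hn0.le]
    linarith
  calc _ ≤ 4 * n ^ 3 * n := mul_le_mul_of_nonneg_right h10 hn0.le
    _ = 4 * n ^ 4 := by ring

end Rate

/-! ### Uniform closeness of the two EIPMs -/

section Uniform

variable {X Z : Type*} [MeasurableSpace X] [MetricSpace Z] [MeasurableSpace Z] [BorelSpace Z]
  [StandardBorelSpace Z] [Nonempty Z]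

/-- For one sample size, the probability that the two EIPMs differ by more than a multiple of the
rate for some encoder. When the deviation scale exceeds one the assertion is trivial, because both
quantities lie in `[0, 2]`; otherwise the sample is good with high probability. -/
lemma measure_exists_lt_abs_sub_le {P : Measure (X × ℝ)} [IsProbabilityMeasure P]
    {κ : Kernel ℝ X} [IsMarkovKernel κ] (hκ : P.map Prod.swap = (P.map Prod.snd) ⊗ₘ κ)
    {k : ℝ → ℝ} (hk : IsSmoothingFunction k) {M : ℝ} (hM : ∀ s, k s ≤ M) {γ C c₀ : ℝ} {b : ℝ → ℝ}
    (hC : 0 < C) (hc₀ : 0 < c₀) (hγ : 0 < γ) (hγ1 : γ ≤ 1) (hb : KernelEstimates P κ k γ C c₀ b)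
    {L : ℝ≥0} {V : Set (Z → ℝ)} {H : Set (X → Z)} (hL : 0 < L)
    (hV : ∀ v ∈ V, LipschitzWith L v ∧ ∀ z, |v z| ≤ 1) (hH : ∀ h ∈ H, Measurable h)
    (hcov : ∀ r : ℝ≥0, 0 < r → supCoveringNumber r V ≠ ⊤ ∧ supCoveringNumber r H ≠ ⊤)
    {m : ℕ} (hm : 2 ≤ m) :
    (Measure.pi fun _ : Fin (m + 1) => P)
        {ω | ∃ h ∈ H, (2 * (28 + 8 * √(C + 2 * M ^ 2) / c₀ + 2 * C) + C) * rate γ L V H (m + 1)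
          < |estEIPM k γ V h ω - EIPM P V h|}
      ≤ ENNReal.ofReal (4 / (m + 1 : ℕ)) := by
  classical
  have hprob : IsProbabilityMeasure (P.map Prod.fst) :=
    Measure.isProbabilityMeasure_map measurable_fst.aemeasurable
  have hprob' : IsProbabilityMeasure (P.map Prod.snd) :=
    Measure.isProbabilityMeasure_map measurable_snd.aemeasurable
  have hV1 : ∀ v ∈ V, ∀ z, |v z| ≤ 1 := fun v hv => (hV v hv).2
  have hVm : ∀ v ∈ V, Measurable v := fun v hv => (hV v hv).1.continuous.measurable
  have hL' : (0 : ℝ) < L := by exact_mod_cast hL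
  -- the variance bound is enlarged so that the Gaussian regime covers all `t < n γ`
  set C' : ℝ := C + 2 * M ^ 2 with hC'
  have hC'0 : 0 < C' := by positivity
  set K : ℝ := 28 + 8 * √C' / c₀ + 2 * C with hK
  have hK1 : 1 ≤ K := by
    have : 0 ≤ 8 * √C' / c₀ + 2 * C := by positivity
    linarith
  have hm2 : (2 : ℝ) ≤ m := by exact_mod_cast hm
  set n : ℝ := ((m + 1 : ℕ) : ℝ) with hn
  have hnm : n = m + 1 := by simp [hn]
  have hn0 : 0 < n := by linarith
  have hg : 0 < √(γ / n) := Real.sqrt_pos.2 (by positivity)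
  have hrV : 0 < (1 / 2 * √(γ / n)).toNNReal := Real.toNNReal_pos.2 (by positivity)
  have hrH : 0 < (1 / (2 * L) * √(γ / n)).toNNReal := Real.toNNReal_pos.2 (by positivity)
  set N := (supCoveringNumber (1 / 2 * √(γ / n)).toNNReal V).toNat with hN
  set N' := (supCoveringNumber (1 / (2 * L) * √(γ / n)).toNNReal H).toNat with hN'
  have hl := Real.log_natCast_nonneg N
  have hl' := Real.log_natCast_nonneg N'
  set t := 4 * Real.log n + Real.log N + Real.log N' with ht
  set ρ := Real.log n / √(n * γ) * √(1 + Real.log N + Real.log N') with hρ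
  have hrate : rate γ L V H (m + 1) = γ ^ 2 + ρ := rfl
  set R := √(t / (n * γ)) with hR
  have hRρ : R ≤ 2 * ρ := sqrt_div_le hγ (by omega) hl hl'
  have hlog : 1 ≤ Real.log n := by
    rw [Real.le_log_iff_exp_le hn0]
    linarith [Real.exp_one_lt_d9]
  have ht1 : 1 ≤ t := by linarith
  have hbound : K * R + C * γ ^ 2 ≤ (2 * K + C) * rate γ L V H (m + 1) := by
    have hR0 : 0 ≤ R := Real.sqrt_nonneg _
    rw [hrate]
    nlinarith [mul_le_mul_of_nonneg_left hRρ (by linarith : 0 ≤ K), sq_nonneg γ,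
      mul_nonneg (by linarith : 0 ≤ K) (sq_nonneg γ), mul_nonneg hC.le (by linarith : 0 ≤ ρ)]
  have hEIPM : ∀ h ∈ H, EIPM P V h
      = ∫ s, condDiscrepancy κ (P.map Prod.fst) V h s ∂(P.map Prod.snd) := fun h hh =>
    EIPM_eq_integral_condDiscrepancy hκ (hH h hh) hVm
  rcases le_or_gt 1 R with hR1 | hR1
  · -- both quantities lie in `[0, 2]`
    have hempty : {ω : Fin (m + 1) → X × ℝ | ∃ h ∈ H, (2 * K + C) * rate γ L V H (m + 1)
        < |estEIPM k γ V h ω - EIPM P V h|} = ∅ := by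
      refine Set.eq_empty_iff_forall_notMem.2 fun ω hω => ?_
      obtain ⟨h, hh, hlt⟩ := hω
      have e1 := estEIPM_nonneg (γ := γ) (V := V) (h := h) (ω := ω) hk
      have e2 := estEIPM_le_two (γ := γ) (h := h) (ω := ω) hk hV1
      have e3 : 0 ≤ EIPM P V h := by
        rw [hEIPM h hh]
        exact integral_nonneg fun s => condDiscrepancy_nonneg s
      have e4 : EIPM P V h ≤ 2 := by
        rw [hEIPM h hh]
        exact (le_abs_self _).trans (abs_integral_le_of_abs_le (abs_condDiscrepancy_le_two hV1))
      have e5 : |estEIPM k γ V h ω - EIPM P V h| ≤ 2 := by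
        rw [abs_le]
        constructor <;> linarith
      have e6 : 2 ≤ K * R := by
        have : 28 ≤ K := by
          have : 0 ≤ 8 * √C' / c₀ + 2 * C := by positivity
          linarith
        nlinarith
      have : 0 ≤ C * γ ^ 2 := by positivity
      linarith
    rw [hempty, measure_empty]
    exact zero_le
  · -- the Gaussian regime: a good sample, with the centres of the covers as test objects
    have htn : t < n * γ := by
      have h1 : R ^ 2 < 1 := by
        have : 0 ≤ R := Real.sqrt_nonneg _
        nlinarith
      rw [hR, Real.sq_sqrt (by positivity), div_lt_one (by positivity)] at h1
      exact h1
    have htm : M ^ 2 * t ≤ m * (C' * γ) := by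
      have h1 : M ^ 2 * t ≤ M ^ 2 * (2 * m * γ) := by
        refine mul_le_mul_of_nonneg_left (htn.le.trans ?_) (sq_nonneg _)
        exact mul_le_mul_of_nonneg_right (by linarith) hγ.le
      have h2 : 0 ≤ C * m * γ := by positivity
      calc M ^ 2 * t ≤ 2 * M ^ 2 * m * γ + C * m * γ := by linarith
        _ = m * (C' * γ) := by rw [hC']; ring
    have htn' : t ≤ (m + 1 : ℕ) := htn.le.trans (mul_le_of_le_one_right hn0.le hγ1)
    obtain ⟨CV, hCV, hCVcard, hCVcov⟩ := exists_finset_cover (hcov _ hrV).1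
    obtain ⟨CH, hCH, hCHcard, hCHcov⟩ := exists_finset_cover (hcov _ hrH).2
    rw [Real.coe_toNNReal _ (by positivity)] at hCVcov hCHcov
    -- the constant function `1` accounts for the denominators of the weights
    set F : Finset (X → ℝ) :=
      insert (fun _ => 1) (Finset.image₂ (fun (v : Z → ℝ) (h : X → Z) x => v (h x)) CV CH) with hF
    set G : Finset (ℝ → ℝ) := CH.image (condDiscrepancy κ (P.map Prod.fst) V) with hG
    have hFm : ∀ f ∈ F, Measurable f ∧ ∀ x, |f x| ≤ 1 := by
      intro f hf
      rcases Finset.mem_insert.1 hf with rfl | hf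
      · exact ⟨measurable_const, fun _ => by simp⟩
      · obtain ⟨v, hv, h, hh, rfl⟩ := Finset.mem_image₂.1 hf
        exact ⟨(hVm v (hCV v hv)).comp (hH h (hCH h hh)), fun x => hV1 v (hCV v hv) _⟩
    have hGm : ∀ Φ ∈ G, Measurable Φ ∧ ∀ s, |Φ s| ≤ 2 := by
      intro Φ hΦ
      obtain ⟨h, hh, rfl⟩ := Finset.mem_image.1 hΦ
      exact ⟨measurable_condDiscrepancy hV1
        (fun v hv => (hVm v hv).comp (hH h (hCH h hh))) (fun r hr => (hcov r hr).1),
        abs_condDiscrepancy_le_two hV1⟩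
    have hprobGood := measure_not_isGoodSample_le (F := F) (G := G) hk hM hγ hC
      (by rw [hC']; nlinarith [sq_nonneg M] : C ≤ C') hb hFm hGm (by omega) (by linarith) htm htn'
    have hFcard : F.card ≤ N * N' + 1 := by
      refine (Finset.card_insert_le _ _).trans (Nat.add_le_add_right ?_ 1)
      exact (Finset.card_image₂_le _ _ _).trans (Nat.mul_le_mul hCVcard hCHcard)
    have hGcard : G.card ≤ N' := Finset.card_image_le.trans hCHcard
    refine (measure_mono fun ω hω => ?_).trans
      (hprobGood.trans (ENNReal.ofReal_le_ofReal
        (failure_probability_le (by omega) hFcard hGcard)))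
    intro hgood
    obtain ⟨h, hh, hlt⟩ := hω
    obtain ⟨h', hh', hhd⟩ := hCHcov h hh
    have hLip : ∀ v ∈ V, ∀ x, |v (h x) - v (h' x)| ≤ √(γ / n) := fun v hv x => by
      have e1 := (hV v hv).1.dist_le_mul (h x) (h' x)
      rw [Real.dist_eq] at e1
      refine e1.trans ((mul_le_mul_of_nonneg_left (hhd x) hL'.le).trans (le_of_eq ?_))
      field_simp
    have hfin := hgood.abs_estEIPM_sub_le (V := V) (h := h) (h' := h') hk hb hγ hc₀ (by omega)
      (Finset.mem_insert_self _ _) (r := 2 * √(γ / n)) (by positivity) hV1 hVm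
      (fun r hr => (hcov r hr).1) (hH h hh) (hH h' (hCH h' hh'))
      (fun v hv x => (hLip v hv x).trans (by linarith)) (fun v hv => by
        obtain ⟨v', hv', hvd⟩ := hCVcov v hv
        refine ⟨v', hCV v' hv', Finset.mem_insert_of_mem
          (Finset.mem_image₂.2 ⟨v', hv', h', hh', rfl⟩), fun x => ?_⟩
        have e1 := hvd (h' x)
        rw [Real.dist_eq] at e1
        have e2 := hLip v hv x
        have e3 := abs_sub_le (v (h x)) (v (h' x)) (v' (h' x))
        linarith)
      (Finset.mem_image_of_mem _ hh')
    rw [← hEIPM h hh] at hfin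
    have herr := error_le (m := m) (by omega) hγ hγ1 ht1 hC hC'0 hc₀
    linarith

end Uniform

end FairRep

theorem mainTheorem2 {X : Type*} [MeasurableSpace X]
    (𝒮 : Set ℝ) (h𝒮 : 𝒮.OrdConnected)
    (P : Measure (X × ℝ)) [IsProbabilityMeasure P]
    (hPS : FairRep.HasBoundedDensity P 𝒮) (hPXS : FairRep.HasSmoothJointDensity P 𝒮)
    (k : ℝ → ℝ) (hk : FairRep.IsSmoothingFunction k)
    (γ : ℕ → ℝ) (hγ_pos : ∀ n, 0 < γ n) (hγ_zero : Tendsto γ atTop (𝓝 0))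
    (hγ_top : Tendsto (fun n : ℕ => (n : ℝ) * γ n) atTop atTop) :
    ∃ c : ℝ, 0 < c ∧
      ∀ (Z : Type*) [MetricSpace Z] [SecondCountableTopology Z] [MeasurableSpace Z] [BorelSpace Z]
        [StandardBorelSpace Z] [Nonempty Z] (L : ℝ≥0) (V : Set (Z → ℝ)) (H : Set (X → Z)),
        0 < L →
        (∀ v ∈ V, LipschitzWith L v ∧ ∀ z, |v z| ≤ 1) →
        (∀ h ∈ H, Measurable h) →
        (∀ r : ℝ≥0, 0 < r →
          FairRep.supCoveringNumber r V ≠ ⊤ ∧ FairRep.supCoveringNumber r H ≠ ⊤) →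
        ∀ δ : ℝ, 0 < δ → ∀ᶠ n : ℕ in atTop,
          -- the (outer) probability that the inclusions fail is at most `4 / n`
          (Measure.pi fun _ : Fin n => P)
              {ω | ¬ (FairRep.fairEncoders P V H (δ - c * FairRep.rate (γ n) L V H n)
                        ⊆ FairRep.estFairEncoders k (γ n) V H ω δ ∧
                      FairRep.estFairEncoders k (γ n) V H ω δ
                        ⊆ FairRep.fairEncoders P V H (δ + c * FairRep.rate (γ n) L V H n))}
            ≤ ENNReal.ofReal (4 / n) := by
  obtain ⟨κ, hκ, hdis, C, c₀, γ₀, hC, hc₀, hγ₀, hest⟩ :=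
    FairRep.exists_kernelEstimates h𝒮 hPS hPXS hk
  obtain ⟨M, hM⟩ := hk.bounded
  refine ⟨2 * (28 + 8 * √(C + 2 * M ^ 2) / c₀ + 2 * C) + C, by positivity, ?_⟩
  intro Z _ _ _ _ _ _ L V H hL hV hH hcov δ _
  have hsmall : ∀ᶠ n in atTop, γ n < min 1 γ₀ :=
    hγ_zero.eventually_lt_const (lt_min one_pos hγ₀)
  -- `log n ≥ 1` for `n ≥ 3`, so that `log n` absorbs constants
  filter_upwards [hsmall, eventually_ge_atTop 3] with n hn hn3
  obtain ⟨m, rfl⟩ : ∃ m, n = m + 1 := ⟨n - 1, by omega⟩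
  obtain ⟨b, hb⟩ := hest (γ (m + 1)) (hγ_pos _) (hn.le.trans (min_le_right _ _))
  refine (measure_mono fun ω hω => ?_).trans
    (FairRep.measure_exists_lt_abs_sub_le hdis hk hM hC hc₀ (hγ_pos _)
      (hn.le.trans (min_le_left _ _)) hb hL hV hH hcov (by omega))
  by_contra hcon
  have hclose : ∀ h ∈ H, |FairRep.estEIPM k (γ (m + 1)) V h ω - FairRep.EIPM P V h|
      ≤ (2 * (28 + 8 * √(C + 2 * M ^ 2) / c₀ + 2 * C) + C)
        * FairRep.rate (γ (m + 1)) L V H (m + 1) :=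
    fun h hh => not_lt.1 fun hlt => hcon ⟨h, hh, hlt⟩
  refine hω ⟨fun h hh => ⟨hh.1, ?_⟩, fun h hh => ⟨hh.1, ?_⟩⟩
  · linarith [(abs_le.1 (hclose h hh.1)).2, hh.2]
  · linarith [(abs_le.1 (hclose h hh.1)).1, hh.2]
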